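/- **Setting.** Let $L_\cap=\{R\}$, $L_1=\{R,E_1\}$, $L_2=\{R,E_2\}$ and $L_\cup=\{R,E_1,E_2\}$, where $R$ is a ternary relation symbol and $E_1\neq E_2$ are binary relation symbols. A $3$-hypergraph relation is a symmetric ternary relation that holds only of triples of distinct elements; a graph relation is a symmetric anti-reflexive binary relation. Let $\mathscr K$ be the class of finite $3$-hypergraphs $(V;R)$. Let $\mathscr K_1$ (respectively $\mathscr K_2$) be the class of finite structures $(V;R,E_i)$ such that $R$ is a $3$-hypergraph relation, $E_i$ is a graph relation and every $E_1$-triangle $x,y,z$ satisfies $R(x,y,z)$ (respectively every $E_2$-triangle $x,y,z$ satisfies $\neg R(x,y,z)$). The Henson graph is the Fraïssé limit of the class of finite triangle-free graphs. For an $L_1$-theory $T_1$ and an $L_2$-theory $T_2$ put $T_\cup=T_1\cup T_2$. A model $\mathscr M$ of $T_\cup$ is *interpolative* if, for every $J\subseteq\{1,2\}$ and all sets $X_i\subseteq M^n$ ($i\in J$) definable with parameters in the $L_i$-reduct of $\mathscr M$ with $\bigcap_{i\in J}X_i=\emptyset$, there are sets $Y_i\supseteq X_i$ ($i\in J$) definable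 with parameters in the $L_\cap$-reduct of $\mathscr M$ with $\bigcap_{i\in J}Y_i=\emptyset$. The *interpolative fusion* $T^*_\cup$ is the theory of the class of interpolative models of $T_\cup$, and it is said to *exist* if this class is elementary. A theory has *trivial* $\mathrm{acl}$ if $\mathrm{acl}(A)=A$ for every set $A$ in every model. **Proposition.** The classes $\mathscr K,\mathscr K_1,\mathscr K_2$ have Fraïssé limits. Let $T_\cap$ (the theory of the random $3$-hypergraph), $T_1$ and $T_2$ be the complete theories of these limits. Then: 1. $T_\cap$ is the set of $L_\cap$-consequences of $T_1$, and also of $T_2$. 2. Each of $T_\cap,T_1,T_2$ is simple and $\aleph_0$-categorical and has trivial $\mathrm{acl}$. 3. The interpolative fusion $T^*_\cup$ of $T_1$ and $T_2$ over $T_\cap$ exists, and it is complete and $\aleph_0$-categorical. 4. The Henson graph exists, and its theory is interpretable in $T^*_\cup$. 5. $T^*_\cup$ has $\mathrm{SOP}_3$ and is not $\mathrm{NSOP}_1$. 6. $T_1$ and $T_2$ are $\mathrm{NSOP}_1$, while $T_\cap$ is not stable. Hence an interpolative fusion of two $\mathrm{NSOP}_1$ theories with trivial $\mathrm{acl}$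 over an unstable theory need not be $\mathrm{NSOP}_1$. -/

import Mathlib

open FirstOrder FirstOrder.Language Cardinal

/-! ## Classification-theoretic notions, for one-sorted first-order theories -/

namespace ModelTheoreticNotions

variable {L : FirstOrder.Language.{0, 0}}

/-- The algebraic closure of `A` in the `L`-structure `M`: the union of all finite subsets of `M`
which are definable with parameters from `A`. -/
def acl (L : FirstOrder.Language.{0, 0}) {M : Type} [L.Structure M] (A : Set M) : Set M :=
  {b | ∃ S : Set M, A.Definable₁ L S ∧ S.Finite ∧ b ∈ S}

/-- `T` has trivial algebraic closure: `acl(A) = A` for every set `A` in every model. -/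
def HasTrivialAcl (T : L.Theory) : Prop :=
  ∀ (M : Theory.ModelType.{0, 0, 0} T) (A : Set M), acl L A = A

/-- `T` is `ℵ₀`-categorical: it has, up to isomorphism, exactly one model of size `ℵ₀`. -/
def IsAlephZeroCategorical (T : L.Theory) : Prop :=
  (∃ M : Theory.ModelType.{0, 0, 0} T, #M = ℵ₀) ∧ Categorical (ℵ₀ : Cardinal.{0}) T

/-- The formula `φ(x; y)` has the order property in some model of `T`. -/
def HasOrderProperty (T : L.Theory) {m n : ℕ} (φ : L.Formula (Fin m ⊕ Fin n)) : Prop :=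
  ∃ (M : Theory.ModelType.{0, 0, 0} T) (a : ℕ → Fin m → M) (b : ℕ → Fin n → M),
    ∀ i j, φ.Realize (Sum.elim (a i) (b j)) ↔ i < j

/-- `T` is stable: no formula has the order property. -/
def IsStable (T : L.Theory) : Prop :=
  ∀ (m n : ℕ) (φ : L.Formula (Fin m ⊕ Fin n)), ¬ HasOrderProperty T φ

/-- The finite sequence `(σ 0, …, σ (n - 1))`. -/
def initialSegment {α : Type} (σ : ℕ → α) (n : ℕ) : List α := (List.range n).map σ

/-- The formula `φ(x; y)` has the `k`-tree property relative to `T`: there are parameters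
`b η`, indexed by the finite sequences `η` of natural numbers, such that for every `η` the set
`{φ(x; b (η⌢i)) | i ∈ ℕ}` is `k`-inconsistent and along every branch `σ` the set
`{φ(x; b (σ|j)) | j ∈ ℕ}` is (finitely) consistent. -/
def HasTreeProperty (T : L.Theory) {m n : ℕ} (φ : L.Formula (Fin m ⊕ Fin n)) (k : ℕ) : Prop :=
  ∃ (M : Theory.ModelType.{0, 0, 0} T) (b : List ℕ → Fin n → M),
    (∀ (η : List ℕ) (s : Finset ℕ), s.card = k →
      ¬ ∃ a : Fin m → M, ∀ i ∈ s, φ.Realize (Sum.elim a (b (η ++ [i])))) ∧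
    (∀ (σ : ℕ → ℕ) (N : ℕ),
      ∃ a : Fin m → M, ∀ j ≤ N, φ.Realize (Sum.elim a (b (initialSegment σ j))))

/-- `T` is simple: no formula has the `k`-tree property for any `k ≥ 2`. -/
def IsSimple (T : L.Theory) : Prop :=
  ∀ (m n : ℕ) (φ : L.Formula (Fin m ⊕ Fin n)) (k : ℕ), 2 ≤ k → ¬ HasTreeProperty T φ k

/-- The formula `φ(x; y)` has `SOP₁` relative to `T`: there are parameters `b η`, indexed by the
finite binary sequences `η`, such that `φ(x; b η)` and `φ(x; b (ν⌢1))` are inconsistent whenever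
`η` extends `ν⌢0`, and along every branch `σ` the set `{φ(x; b (σ|j)) | j ∈ ℕ}` is (finitely)
consistent. -/
def HasSOP1 (T : L.Theory) {m n : ℕ} (φ : L.Formula (Fin m ⊕ Fin n)) : Prop :=
  ∃ (M : Theory.ModelType.{0, 0, 0} T) (b : List Bool → Fin n → M),
    (∀ ν η : List Bool, (ν ++ [false]) <+: η →
      ¬ ∃ a : Fin m → M, φ.Realize (Sum.elim a (b η)) ∧
        φ.Realize (Sum.elim a (b (ν ++ [true])))) ∧
    (∀ (σ : ℕ → Bool) (N : ℕ),
      ∃ a : Fin m → M, ∀ j ≤ N, φ.Realize (Sum.elim a (b (initialSegment σ j))))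

/-- `T` is `NSOP₁`: no formula has `SOP₁`. -/
def IsNSOP1 (T : L.Theory) : Prop :=
  ∀ (m n : ℕ) (φ : L.Formula (Fin m ⊕ Fin n)), ¬ HasSOP1 T φ

/-- `T` has `SOP₃`: some formula `φ(x, y)` with `|x| = |y|` has, in some model, an infinite chain
`φ(aᵢ, aⱼ)` for `i < j`, but no directed cycle of length three. -/
def HasSOP3 (T : L.Theory) : Prop :=
  ∃ (n : ℕ) (φ : L.Formula (Fin n ⊕ Fin n)) (M : Theory.ModelType.{0, 0, 0} T),
    (∃ a : ℕ → Fin n → M, ∀ i j, i < j → φ.Realize (Sum.elim (a i) (a j))) ∧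
    ¬ ∃ x y z : Fin n → M, φ.Realize (Sum.elim x y) ∧ φ.Realize (Sum.elim y z) ∧
      φ.Realize (Sum.elim z x)

/-- `T` is the complete theory of the Fraïssé limit of the class `K`. -/
def IsTheoryOfFraisseLimit [Countable (Σ l, L.Functions l)]
    (K : Set (CategoryTheory.Bundled.{0} L.Structure)) (T : L.Theory) : Prop :=
  ∃ (M : Type) (_ : L.Structure M) (_ : Countable M),
    IsFraisseLimit K M ∧ T = L.completeTheory M

/-! ### Interpretations -/

/-- The formulas of an interpretation of `L`-structures in `L'`-structures: a domain formula, a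
formula for equality, and formulas for the symbols of `L`; an element of the interpreted structure
is represented by a tuple of length `dim`. -/
structure InterpretationData (L L' : FirstOrder.Language.{0, 0}) where
  dim : ℕ
  dom : L'.Formula (Fin dim)
  eqv : L'.Formula (Fin 2 × Fin dim)
  rel : ∀ {k : ℕ}, L.Relations k → L'.Formula (Fin k × Fin dim)
  fn : ∀ {k : ℕ}, L.Functions k → L'.Formula (Fin (k + 1) × Fin dim)

/-- The formulas of `F`, evaluated in `M`, define the `L`-structure `N`: there is a surjection `π`
from the set defined by the domain formula onto `N`, whose kernel is the relation defined by the
equality formula, and under which the other formulas define the relations and the graphs of the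
functions of `N`. -/
def InterpretationData.Defines {L L' : FirstOrder.Language.{0, 0}} (F : InterpretationData L L')
    (M N : Type) [L'.Structure M] [L.Structure N] : Prop :=
  ∃ π : {a : Fin F.dim → M // F.dom.Realize a} → N,
    Function.Surjective π ∧
    (∀ a b, F.eqv.Realize (fun p => (![a, b] p.1).1 p.2) ↔ π a = π b) ∧
    (∀ (k : ℕ) (R : L.Relations k) (a : Fin k → {a : Fin F.dim → M // F.dom.Realize a}),
      (F.rel R).Realize (fun p => (a p.1).1 p.2) ↔ Structure.RelMap R (fun i => π (a i))) ∧
    (∀ (k : ℕ) (f : L.Functions k) (a : Fin (k + 1) → {a : Fin F.dim → M // F.dom.Realize a}),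
      (F.fn f).Realize (fun p => (a p.1).1 p.2) ↔
        Structure.funMap f (fun i : Fin k => π (a i.castSucc)) = π (a (Fin.last k)))

/-- The theory `T` is interpretable in the theory `T'`. -/
def IsInterpretableIn {L L' : FirstOrder.Language.{0, 0}} (T : L.Theory) (T' : L'.Theory) : Prop :=
  ∃ F : InterpretationData L L', ∀ M : Theory.ModelType.{0, 0, 0} T',
    ∃ N : Theory.ModelType.{0, 0, 0} T, F.Defines M N

end ModelTheoreticNotions

/-! ## Interpolative fusions

A family of languages `(Lᵢ)` with `Lᵢ ∩ Lⱼ = L₀` for `i ≠ j` is given by the common part `L₀` and,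
for each `i`, the language `X i` of the symbols of `Lᵢ` outside `L₀`: thus `Lᵢ = L₀ ⊔ X i`, and the
union of all `Lᵢ` is `L₀ ⊔ ⨆ᵢ X i`, with disjoint copies of the `X i`. -/

namespace InterpolativeFusion

variable {I : Type} (L₀ : FirstOrder.Language.{0, 0}) (X : I → FirstOrder.Language.{0, 0})

/-- The disjoint union of a family of languages. -/
def sigmaLanguage : FirstOrder.Language.{0, 0} :=
  ⟨fun n => Σ i, (X i).Functions n, fun n => Σ i, (X i).Relations n⟩

/-- The language `L_∪`. -/
abbrev unionLanguage : FirstOrder.Language.{0, 0} := L₀.sum (sigmaLanguage X)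

/-- The inclusion of `L_∩` into `L_∪`. -/
def baseIncl : L₀ →ᴸ unionLanguage L₀ X := LHom.sumInl

/-- The inclusion of `X i` into the disjoint union of the family. -/
def sigmaIncl (i : I) : X i →ᴸ sigmaLanguage X :=
  ⟨fun _ f => ⟨i, f⟩, fun _ r => ⟨i, r⟩⟩

/-- The inclusion of `Lᵢ` into `L_∪`. -/
def incl (i : I) : L₀.sum (X i) →ᴸ unionLanguage L₀ X :=
  LHom.sumMap (LHom.id L₀) (sigmaIncl X i)

/-- `S` is definable, with parameters, in the reduct of `M` along `ψ`. -/
def ReductDefinable {L L' : FirstOrder.Language.{0, 0}} (ψ : L →ᴸ L') {M : Type}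
    [L'.Structure M] {n : ℕ} (S : Set (Fin n → M)) : Prop :=
  letI : L.Structure M := ψ.reduct M
  (Set.univ : Set M).Definable L S

/-- The `L_∪`-structure `M` is interpolative: whenever finitely many sets `S i`, with `S i`
definable in the `Lᵢ`-reduct, have empty intersection, they are contained in `L_∩`-definable sets
`Y i` with empty intersection. -/
def IsInterpolative (M : Type) [(unionLanguage L₀ X).Structure M] : Prop :=
  ∀ (n : ℕ) (J : Finset I) (S : I → Set (Fin n → M)),
    (∀ i ∈ J, ReductDefinable (incl L₀ X i) (S i)) →
    (⋂ i ∈ J, S i) = ∅ →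
    ∃ Y : I → Set (Fin n → M),
      (∀ i ∈ J, ReductDefinable (baseIncl L₀ X) (Y i) ∧ S i ⊆ Y i) ∧ (⋂ i ∈ J, Y i) = ∅

variable {L₀ X}

/-- `T₀` is the set of `L_∩`-consequences of the `Lᵢ`-theory `T`. -/
def IsBaseConsequences {i : I} (T₀ : L₀.Theory) (T : (L₀.sum (X i)).Theory) : Prop :=
  ∀ φ : L₀.Sentence, φ ∈ T₀ ↔ T ⊨ᵇ (LHom.sumInl : L₀ →ᴸ L₀.sum (X i)).onSentence φ

/-- The union `T_∪` of the theories `Tᵢ`. -/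
def unionTheory (T : ∀ i, (L₀.sum (X i)).Theory) : (unionLanguage L₀ X).Theory :=
  ⋃ i, (incl L₀ X i).onTheory (T i)

/-- The interpolative fusion exists: the class of interpolative models of `T_∪` is elementary. -/
def FusionExists (T : ∀ i, (L₀.sum (X i)).Theory) : Prop :=
  ∃ T' : (unionLanguage L₀ X).Theory,
    ∀ (M : Type) [Nonempty M] [(unionLanguage L₀ X).Structure M],
      M ⊨ T' ↔ (M ⊨ unionTheory T ∧ IsInterpolative L₀ X M)

/-- The theory `T*_∪` of the class of interpolative models of `T_∪`. -/
def fusion (T : ∀ i, (L₀.sum (X i)).Theory) : (unionLanguage L₀ X).Theory :=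
  {φ | ∀ (M : Type) [Nonempty M] [(unionLanguage L₀ X).Structure M],
    M ⊨ unionTheory T → IsInterpolative L₀ X M → M ⊨ φ}

end InterpolativeFusion

/-! ## The classes of finite structures -/

namespace HypergraphExample

open Structure

/-- The only symbol of the language of 3-hypergraphs is a ternary relation symbol. -/
inductive HypergraphRel : ℕ → Type
  | edge : HypergraphRel 3

/-- The language `{R}` of 3-hypergraphs. -/
def hypergraphLanguage : FirstOrder.Language.{0, 0} := ⟨fun _ => Empty, HypergraphRel⟩

instance : hypergraphLanguage.IsRelational := fun _ => inferInstanceAs (IsEmpty Empty)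

/-- The ternary relation symbol `R`. -/
def hyperedgeSymbol : hypergraphLanguage.Relations 3 := HypergraphRel.edge

/-- A ternary relation is a 3-hypergraph relation if it is symmetric (under all permutations) and
holds only for triples of distinct elements. -/
def IsHypergraphRelation {V : Type} (r : V → V → V → Prop) : Prop :=
  ∀ a b c, r a b c → (r b a c ∧ r b c a) ∧ (a ≠ b ∧ b ≠ c ∧ a ≠ c)

/-- A binary relation is a graph relation if it is symmetric and anti-reflexive. -/
def IsGraphRelation {V : Type} (e : V → V → Prop) : Prop :=
  (∀ a b, e a b → e b a) ∧ ∀ a, ¬ e a a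

/-- The class of finite 3-hypergraphs. -/
def finiteHypergraphs : Set (CategoryTheory.Bundled.{0} hypergraphLanguage.Structure) :=
  {V | Finite V ∧ IsHypergraphRelation fun a b c : V => RelMap hyperedgeSymbol ![a, b, c]}

/-- The language `{R, E}` with `E` binary. -/
abbrev expandedLanguage : FirstOrder.Language.{0, 0} :=
  hypergraphLanguage.sum FirstOrder.Language.graph

/-- The relation `R(a, b, c)` in an `{R, E}`-structure. -/
def hyperedge {V : Type} [expandedLanguage.Structure V] (a b c : V) : Prop :=
  RelMap (L := expandedLanguage) (n := 3) (Sum.inl hyperedgeSymbol) ![a, b, c]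

/-- The relation `E(a, b)` in an `{R, E}`-structure. -/
def edge {V : Type} [expandedLanguage.Structure V] (a b : V) : Prop :=
  RelMap (L := expandedLanguage) (n := 2) (Sum.inr Language.adj) ![a, b]

/-- The class `K₁` of finite `{R, E}`-structures in which `R` is a 3-hypergraph relation, `E` is a
graph relation, and every `E`-triangle is in `R`. -/
def classK₁ : Set (CategoryTheory.Bundled.{0} expandedLanguage.Structure) :=
  {V | Finite V ∧ IsHypergraphRelation (hyperedge (V := V)) ∧ IsGraphRelation (edge (V := V)) ∧
    ∀ x y z : V, edge x y → edge y z → edge z x → hyperedge x y z}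

/-- The class `K₂` of finite `{R, E}`-structures in which `R` is a 3-hypergraph relation, `E` is a
graph relation, and no `E`-triangle is in `R`. -/
def classK₂ : Set (CategoryTheory.Bundled.{0} expandedLanguage.Structure) :=
  {V | Finite V ∧ IsHypergraphRelation (hyperedge (V := V)) ∧ IsGraphRelation (edge (V := V)) ∧
    ∀ x y z : V, edge x y → edge y z → edge z x → ¬ hyperedge x y z}

/-- The class of finite triangle-free graphs, whose Fraïssé limit is the Henson graph. -/
def finiteTriangleFreeGraphs :
    Set (CategoryTheory.Bundled.{0} FirstOrder.Language.graph.Structure) :=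
  {V | Finite V ∧ IsGraphRelation (fun a b : V => RelMap Language.adj ![a, b]) ∧
    ∀ x y z : V, ¬ (RelMap Language.adj ![x, y] ∧ RelMap Language.adj ![y, z] ∧
      RelMap Language.adj ![z, x])}

/-- The symbols of `L₁ = {R, E₁}` and of `L₂ = {R, E₂}` outside `L_∩ = {R}`: one binary relation
symbol each. In the union `L_∪ = {R, E₁, E₂}` the two are different symbols. -/
abbrev extraSymbols : Fin 2 → FirstOrder.Language.{0, 0} := fun _ => FirstOrder.Language.graph

/-- Two theories, in `{R, E₁}` and in `{R, E₂}`, as a family. -/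
def pair (T₁ T₂ : expandedLanguage.Theory) :
    ∀ i : Fin 2, (hypergraphLanguage.sum (extraSymbols i)).Theory := ![T₁, T₂]

end HypergraphExample

open ModelTheoreticNotions InterpolativeFusion HypergraphExample

/-! All theories involved are instances of one construction: hypergraphs whose pairs may carry edges
of colours `i : I`, with the rule that a triangle of colour `i` is a hyperedge if and only if `sgn
i`. There is no colour for $T_\cap$, one colour of sign true or false for $T_1$ or $T_2$, and both
colours for the fusion. Such a structure is generic if every one-vertex extension over a finite set
that obeys the rules is realized. Back-and-forth between generic structures gives quantifier
elimination, completeness, $\aleph_0$-categoricity and the Fraïssé limit; since realizations can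
avoid any finite set, `acl` is trivial.

With at most one colour the theory is simple. By `Generic.exists_simultaneous`, if `a` is related to
`b`, then some `a'` is related in the same way to many copies of `b` at once: hyperedges between a
new vertex and vertices of two different copies are free, and giving them the value `sgn` satisfies
the only rule. Two colours of opposite sign leave no legal value for such a triple when it is a
triangle in both.

A model of $T_\cup$ is interpolative exactly when it is generic for both colours
(`model_fusion_iff`). Each rule involves $R$ and a single colour, so an $L_1$-type and an $L_2$-type
over the same finite set can be realized together as soon as they agree on $R$
(`Generic.exists_common`); this is interpolation. Conversely, interpolation applied to the two
halves of an extension type yields a common realization.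

In the fusion, the pairs carrying both colours form a graph without triangles, as a triangle would
have to be a hyperedge and not to be one. Every triangle-free one-vertex extension of this graph is
realized, so it is elementarily equivalent to the Henson graph, and embedding suitable triangle-free
graphs yields $\mathrm{SOP}_3$ and $\mathrm{SOP}_1$. Finally, $R$ alone codes a half-graph, so
$T_\cap$ is unstable. -/

/-! ## Atomic types and back-and-forth systems in relational languages -/

namespace AtomicTypes

open Structure

/-- The atomic type of a tuple: which entries coincide, and which relations hold between them. -/
def atomicType (L : FirstOrder.Language.{0, 0}) {α M : Type} [L.Structure M] (f : α → M) :
    (α → α → Prop) × (∀ r : Σ k, L.Relations k, (Fin r.1 → α) → Prop) :=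
  (fun x y => f x = f y, fun r v => RelMap r.2 (f ∘ v))

section

variable {L : FirstOrder.Language.{0, 0}} {M N : Type} [L.Structure M] [L.Structure N]
  {α β : Type}

theorem atomicType_eq_iff {f : α → M} {g : α → N} :
    atomicType L f = atomicType L g ↔ (∀ x y, f x = f y ↔ g x = g y) ∧
      ∀ k (r : L.Relations k) (v : Fin k → α), RelMap r (f ∘ v) ↔ RelMap r (g ∘ v) := by
  simp only [atomicType, Prod.mk.injEq, funext_iff, eq_iff_iff, Sigma.forall]

theorem atomicType_comp {f : α → M} {g : α → N} (h : atomicType L f = atomicType L g)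
    (e : β → α) : atomicType L (f ∘ e) = atomicType L (g ∘ e) := by
  rw [atomicType_eq_iff] at h ⊢
  exact ⟨fun x y => h.1 _ _, fun k r v => h.2 k r (e ∘ v)⟩

theorem atomicType_embedding_comp (e : M ↪[L] N) (f : α → M) :
    atomicType L (e ∘ f) = atomicType L f := by
  rw [atomicType_eq_iff]
  exact ⟨fun x y => e.injective.eq_iff, fun k r v => e.map_rel r (f ∘ v)⟩

/-- A map on `M` preserving the atomic type of the enumeration of `M` is an embedding. -/
def embeddingOfAtomicType [L.IsRelational] (g : M → N)
    (h : atomicType L (id : M → M) = atomicType L g) : M ↪[L] N where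
  toFun := g
  inj' x y := ((atomicType_eq_iff.1 h).1 x y).2
  map_fun' f := isEmptyElim f
  map_rel' r v := ((atomicType_eq_iff.1 h).2 _ r v).symm

open Classical in
/-- The formula saying that a tuple has a given atomic type. -/
noncomputable def atomicTypeFormula [Finite (Σ k, L.Relations k)] [Finite α]
    (τ : (α → α → Prop) × (∀ r : Σ k, L.Relations k, (Fin r.1 → α) → Prop)) : L.Formula α :=
  Formula.iInf (fun p : α × α =>
      if τ.1 p.1 p.2 then (Term.equal (var p.1) (var p.2) : L.Formula α)
      else (Term.equal (var p.1) (var p.2) : L.Formula α).not) ⊓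
    Formula.iInf (fun p : Σ r : Σ k, L.Relations k, (Fin r.1 → α) =>
      if τ.2 p.1 p.2 then p.1.2.formula (fun i => (var (p.2 i) : L.Term α))
      else (p.1.2.formula (fun i => (var (p.2 i) : L.Term α))).not)

theorem realize_atomicTypeFormula [Finite (Σ k, L.Relations k)] [Finite α]
    {τ : (α → α → Prop) × (∀ r : Σ k, L.Relations k, (Fin r.1 → α) → Prop)} {f : α → M} :
    (atomicTypeFormula τ).Realize f ↔ atomicType L f = τ := by
  classical
  rw [atomicTypeFormula, Formula.realize_inf, Formula.realize_iInf, Formula.realize_iInf,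
    Prod.ext_iff]
  refine and_congr ?_ ?_
  · simp only [atomicType, funext_iff, eq_iff_iff, Prod.forall]
    refine forall_congr' fun x => forall_congr' fun y => ?_
    split_ifs with h <;> simp [h, Formula.realize_equal]
  · simp only [atomicType, funext_iff, eq_iff_iff]
    refine ⟨fun h r v => ?_, fun h p => ?_⟩
    · have := h ⟨r, v⟩
      dsimp only at this
      split_ifs at this with h' <;> simp [h', Formula.realize_rel] at this ⊢ <;> exact this
    · have := h p.1 p.2
      split_ifs with h' <;> simp [h', Formula.realize_rel] at this ⊢ <;> exact this

variable (L M N) in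
/-- Every finite partial isomorphism from `M` to `N` extends to any further element of `M`. -/
def BackAndForth : Prop :=
  ∀ (α : Type) [Finite α] (f : α → M) (g : α → N), atomicType L f = atomicType L g →
    ∀ x : M, ∃ y : N, atomicType L (fun o : Option α => o.elim x f) =
      atomicType L (fun o : Option α => o.elim y g)

theorem realize_iff_of_atomicType_eq [L.IsRelational] (hMN : BackAndForth L M N)
    (hNM : BackAndForth L N M) [Finite α] {n : ℕ} (φ : L.BoundedFormula α n) :
    ∀ (v : α → M) (xs : Fin n → M) (w : α → N) (ys : Fin n → N),
      atomicType L (Sum.elim v xs) = atomicType L (Sum.elim w ys) →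
        (φ.Realize v xs ↔ φ.Realize w ys) := by
  have term : ∀ {m : ℕ} (t : L.Term (α ⊕ Fin m)), ∃ a, t = var a := by
    intro m t
    cases t with
    | var a => exact ⟨a, rfl⟩
    | func f ts => exact isEmptyElim f
  induction φ with
  | falsum => intros; rfl
  | equal t₁ t₂ =>
    intro v xs w ys h
    obtain ⟨a, rfl⟩ := term t₁
    obtain ⟨b, rfl⟩ := term t₂
    exact (atomicType_eq_iff.1 h).1 a b
  | rel R ts =>
    intro v xs w ys h
    choose a ha using fun i => term (ts i)
    obtain rfl : ts = fun i => var (a i) := funext ha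
    exact (atomicType_eq_iff.1 h).2 _ R a
  | imp φ ψ ih₁ ih₂ =>
    intro v xs w ys h
    exact imp_congr (ih₁ v xs w ys h) (ih₂ v xs w ys h)
  | @all k φ ih =>
    intro v xs w ys h
    -- The quantified variable, last in `Fin (k + 1)`, becomes the point `none` added by
    -- back-and-forth.
    let e : α ⊕ Fin (k + 1) → Option (α ⊕ Fin k) :=
      Sum.elim (fun a => some (Sum.inl a)) (Fin.lastCases none fun i => some (Sum.inr i))
    have key : ∀ {Q : Type} (v : α → Q) (xs : Fin k → Q) (x : Q),
        (fun o : Option (α ⊕ Fin k) => o.elim x (Sum.elim v xs)) ∘ e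
          = Sum.elim v (Fin.snoc xs x : Fin (k + 1) → Q) := by
      intro Q v xs x
      funext o
      rcases o with a | i
      · rfl
      · induction i using Fin.lastCases <;> simp [e]
    rw [BoundedFormula.realize_all, BoundedFormula.realize_all]
    constructor
    · intro H y
      obtain ⟨x, hx⟩ := hNM _ _ _ h.symm y
      have := atomicType_comp hx e
      rw [key, key] at this
      exact (ih _ _ _ _ this.symm).1 (H x)
    · intro H x
      obtain ⟨y, hy⟩ := hMN _ _ _ h x
      have := atomicType_comp hy e
      rw [key, key] at this
      exact (ih _ _ _ _ this).2 (H y)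

theorem formula_realize_iff_of_atomicType_eq [L.IsRelational] (hMN : BackAndForth L M N)
    (hNM : BackAndForth L N M) [Finite α] (φ : L.Formula α) {v : α → M} {w : α → N}
    (h : atomicType L v = atomicType L w) : φ.Realize v ↔ φ.Realize w := by
  refine realize_iff_of_atomicType_eq hMN hNM φ v default w default ?_
  have : ∀ {Q : Type} (v : α → Q) (xs : Fin 0 → Q), Sum.elim v xs = v ∘ Sum.elim id Fin.elim0 := by
    intro Q v xs
    funext o
    rcases o with a | i
    · rfl
    · exact i.elim0
  rw [this v, this w]
  exact atomicType_comp h _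

/-- Without nullary symbols the empty map is a partial isomorphism, which gives back-and-forth its
starting point. -/
theorem atomicType_eq_of_isEmpty [IsEmpty (L.Relations 0)] [IsEmpty α] (f : α → M) (g : α → N) :
    atomicType L f = atomicType L g := by
  rw [atomicType_eq_iff]
  refine ⟨fun x => isEmptyElim x, fun k r v => ?_⟩
  cases k with
  | zero => exact isEmptyElim r
  | succ k => exact isEmptyElim (v 0)

theorem elementarilyEquivalent_of_backAndForth [L.IsRelational] [IsEmpty (L.Relations 0)]
    (hMN : BackAndForth L M N) (hNM : BackAndForth L N M) : M ≅[L] N := by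
  rw [elementarilyEquivalent_iff]
  exact fun φ => formula_realize_iff_of_atomicType_eq hMN hNM φ (atomicType_eq_of_isEmpty _ _)

theorem exists_atomicType_eq [Finite (Σ k, L.Relations k)] (h : M ≅[L] N) [Finite α]
    (f : α → N) : ∃ g : α → M, atomicType L g = atomicType L f := by
  let φ : L.Sentence := Formula.iExs (α := Empty) α
    ((atomicTypeFormula (atomicType L f)).relabel (Sum.inr : α → Empty ⊕ α))
  have hφ : ∀ (Q : Type) [L.Structure Q], Q ⊨ φ ↔ ∃ g : α → Q, atomicType L g = atomicType L f := by
    intro Q _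
    simp only [φ, Sentence.Realize, Formula.realize_iExs, Formula.realize_relabel,
      realize_atomicTypeFormula]
    rfl
  rw [← hφ, elementarilyEquivalent_iff.1 h φ, hφ]
  exact ⟨f, rfl⟩

/-- With finitely many symbols an atomic type of a finite tuple is a single formula. Hence "every
tuple of the type of `f` extends by a point to the type of `F`" is a sentence, true in `M` and
therefore in `N`. -/
theorem BackAndForth.of_elementarilyEquivalent [Finite (Σ k, L.Relations k)]
    (hM : BackAndForth L M M) (h : M ≅[L] N) : BackAndForth L M N := by
  intro α _ f g hfg x
  let F : Option α → M := fun o => o.elim x f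
  let φ : L.Sentence := Formula.iAlls (α := Empty) α
    (((atomicTypeFormula (atomicType L f)).relabel (Sum.inr : α → Empty ⊕ α)).imp
      (Formula.iExs (α := Empty ⊕ α) Unit ((atomicTypeFormula (atomicType L F)).relabel
        (fun o : Option α => o.elim (Sum.inr ()) fun a => Sum.inl (Sum.inr a)))))
  have hφ : ∀ (Q : Type) [L.Structure Q], Q ⊨ φ ↔ ∀ g : α → Q, atomicType L g = atomicType L f →
      ∃ y : Q, atomicType L (fun o : Option α => o.elim y g) = atomicType L F := by
    intro Q _
    have : ∀ (g : α → Q) (i : Unit → Q), (Sum.elim (Sum.elim (default : Empty → Q) g) i ∘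
        fun o : Option α => o.elim (Sum.inr ()) fun a => Sum.inl (Sum.inr a)) =
        fun o : Option α => o.elim (i ()) g := by
      intro g i; funext o; cases o <;> rfl
    simp only [φ, Sentence.Realize, Formula.realize_iAlls, Formula.realize_imp,
      Formula.realize_iExs, Formula.realize_relabel, realize_atomicTypeFormula]
    refine forall_congr' fun g => imp_congr Iff.rfl ?_
    constructor
    · rintro ⟨i, hi⟩
      exact ⟨i (), by rw [← this]; exact hi⟩
    · rintro ⟨y, hy⟩
      exact ⟨fun _ => y, by rw [← this g fun _ => y] at hy; exact hy⟩
  have hN : N ⊨ φ := by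
    rw [← elementarilyEquivalent_iff.1 h φ, hφ]
    intro g hg
    obtain ⟨y, hy⟩ := hM α f g hg.symm x
    exact ⟨y, hy.symm⟩
  obtain ⟨y, hy⟩ := (hφ N).1 hN g hfg.symm
  exact ⟨y, hy.symm⟩

theorem isExtensionPair_of_backAndForth [L.IsRelational] (h : BackAndForth L M N) :
    L.IsExtensionPair M N := by
  rw [isExtensionPair_iff_exists_embedding_closure_singleton_sup]
  intro S hS f m
  have : Finite S := hS.finite
  obtain ⟨y, hy⟩ := h S (fun s => (s : M)) f (by
    have h₁ := atomicType_embedding_comp f (id : S → S)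
    have h₂ := atomicType_embedding_comp S.subtype (id : S → S)
    exact h₂.trans h₁.symm) m
  -- In a relational language the generated substructure is just `S ∪ {m}`. If `m ∈ S`, its
  -- representative in `Option S` is not unique; this is harmless because atomic types record
  -- equalities.
  have hF : ∀ z : (Substructure.closure L {m} ⊔ S : L.Substructure M),
      ∃ o : Option S, o.elim m (fun s => (s : M)) = z := by
    rintro ⟨z, hz⟩
    rw [← SetLike.mem_coe, ← Substructure.closure_eq S, ← Substructure.closure_union,
      SetLike.mem_coe, Substructure.mem_closure_iff_of_isRelational] at hz
    rcases hz with rfl | hz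
    · exact ⟨none, rfl⟩
    · exact ⟨some ⟨z, hz⟩, rfl⟩
  choose e he using hF
  let T := (Substructure.closure L {m} ⊔ S : L.Substructure M)
  have hT : atomicType L (id : T → T) =
      atomicType L ((fun o : Option S => o.elim y f) ∘ e) := by
    rw [← atomicType_comp hy e, ← atomicType_embedding_comp T.subtype (id : T → T)]
    congr 1
    funext z
    exact (he z).symm
  refine ⟨embeddingOfAtomicType _ hT, ?_⟩
  ext s
  have h₁ : (e (Substructure.inclusion le_sup_right s)).elim m (fun s => (s : M)) = s := he _
  have h₂ := ((atomicType_eq_iff.1 hy).1 (e (Substructure.inclusion le_sup_right s)) (some s)).1 h₁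
  exact h₂.symm

theorem exists_embedding_of_backAndForth [L.IsRelational] [IsEmpty (L.Relations 0)] [Countable M]
    (h : BackAndForth L M N) : Nonempty (M ↪[L] N) := by
  have : IsEmpty L.Constants := inferInstanceAs (IsEmpty (L.Functions 0))
  obtain ⟨f, -⟩ := embedding_from_cg Structure.cg_of_countable (default : L.FGEquiv M N)
    (isExtensionPair_of_backAndForth h)
  exact ⟨f⟩

theorem exists_equiv_of_backAndForth [L.IsRelational] [IsEmpty (L.Relations 0)] [Countable M]
    [Countable N] (hMN : BackAndForth L M N) (hNM : BackAndForth L N M) :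
    Nonempty (M ≃[L] N) := by
  have : IsEmpty L.Constants := inferInstanceAs (IsEmpty (L.Functions 0))
  obtain ⟨f, -⟩ := equiv_between_cg Structure.cg_of_countable Structure.cg_of_countable
    (default : L.FGEquiv M N)
    (isExtensionPair_of_backAndForth hMN) (isExtensionPair_of_backAndForth hNM)
  exact ⟨f⟩

theorem isFraisseLimit_of_backAndForth [L.IsRelational] [IsEmpty (L.Relations 0)]
    [Countable (Σ l, L.Functions l)] [Countable M]
    (K : Set (CategoryTheory.Bundled.{0} L.Structure)) (hM : BackAndForth L M M)
    (hK : ∀ V ∈ K, Finite V ∧ BackAndForth L V M)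
    (hfin : ∀ V : CategoryTheory.Bundled.{0} L.Structure, Finite V → (V ↪[L] M) → V ∈ K) :
    IsFraisseLimit K M where
  ultrahomogeneous :=
    (isUltrahomogeneous_iff_IsExtensionPair Structure.cg_of_countable).2
      (isExtensionPair_of_backAndForth hM)
  age := by
    ext V
    constructor
    · rintro ⟨hV, ⟨f⟩⟩
      exact hfin V hV.finite f
    · intro hV
      have := (hK V hV).1
      exact ⟨Structure.FG.of_finite, exists_embedding_of_backAndForth (hK V hV).2⟩

end

end AtomicTypes

/-! ## Hypergraphs with coloured edges -/

/-- A ternary relation together with a family of binary relations. -/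
structure ColoredHypergraph (I V : Type) where
  /-- The hyperedge relation. -/
  R : V → V → V → Prop
  /-- The edge relation of each colour. -/
  E : I → V → V → Prop

namespace ColoredHypergraph

variable {I J V W α β : Type} {sgn : I → Prop}

/-- `R` is a 3-hypergraph relation, every `E i` is a graph relation, and a triangle of colour `i` is
a hyperedge if and only if `sgn i` holds. -/
structure Good (sgn : I → Prop) (c : ColoredHypergraph I V) : Prop where
  hyper : IsHypergraphRelation c.R
  graph : ∀ i, IsGraphRelation (c.E i)
  triangle : ∀ i x y z, c.E i x y → c.E i y z → c.E i z x → (c.R x y z ↔ sgn i)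

theorem Good.R_swap {c : ColoredHypergraph I V} (h : c.Good sgn) {x y z : V} :
    c.R x y z ↔ c.R y x z :=
  ⟨fun H => (h.hyper _ _ _ H).1.1, fun H => (h.hyper _ _ _ H).1.1⟩

theorem Good.R_rotate {c : ColoredHypergraph I V} (h : c.Good sgn) {x y z : V} :
    c.R x y z ↔ c.R y z x :=
  ⟨fun H => (h.hyper _ _ _ H).1.2,
    fun H => (h.hyper _ _ _ (h.hyper _ _ _ H).1.2).1.2⟩

theorem Good.E_symm {c : ColoredHypergraph I V} (h : c.Good sgn) {i : I} {x y : V} :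
    c.E i x y ↔ c.E i y x :=
  ⟨(h.graph i).1 _ _, (h.graph i).1 _ _⟩

/-- The pullback of a coloured hypergraph along a map of vertex sets. -/
def comap (f : α → V) (c : ColoredHypergraph I V) : ColoredHypergraph I α :=
  ⟨fun x y z => c.R (f x) (f y) (f z), fun i x y => c.E i (f x) (f y)⟩

/-- The reduct to some of the colours. -/
def reduct (e : J → I) (c : ColoredHypergraph I V) : ColoredHypergraph J V :=
  ⟨c.R, fun j => c.E (e j)⟩

/-- The isomorphism type of a tuple. -/
def pattern (c : ColoredHypergraph I V) (f : α → V) :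
    (α → α → Prop) × (α → α → α → Prop) × (I → α → α → Prop) :=
  (fun x y => f x = f y, fun x y z => c.R (f x) (f y) (f z), fun i x y => c.E i (f x) (f y))

theorem pattern_eq_iff {c : ColoredHypergraph I V} {d : ColoredHypergraph I W} {f : α → V}
    {g : α → W} : c.pattern f = d.pattern g ↔ (∀ x y, f x = f y ↔ g x = g y) ∧
      (∀ x y z, c.R (f x) (f y) (f z) ↔ d.R (g x) (g y) (g z)) ∧
      ∀ i x y, c.E i (f x) (f y) ↔ d.E i (g x) (g y) := by
  simp only [pattern, Prod.mk.injEq, funext_iff, eq_iff_iff]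

theorem pattern_comp {c : ColoredHypergraph I V} {d : ColoredHypergraph I W} {f : α → V}
    {g : α → W} (h : c.pattern f = d.pattern g) (e : β → α) :
    c.pattern (f ∘ e) = d.pattern (g ∘ e) := by
  rw [pattern_eq_iff] at h ⊢
  exact ⟨fun x y => h.1 _ _, fun x y z => h.2.1 _ _ _, fun i x y => h.2.2 _ _ _⟩

theorem pattern_reduct {c : ColoredHypergraph I V} {d : ColoredHypergraph I W} {f : α → V}
    {g : α → W} (h : c.pattern f = d.pattern g) (e : J → I) :
    (c.reduct e).pattern f = (d.reduct e).pattern g := by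
  rw [pattern_eq_iff] at h ⊢
  exact ⟨h.1, h.2.1, fun i x y => h.2.2 _ _ _⟩

/-- The axioms are universal and mention at most three vertices, so it suffices that every triple is
copied from a good structure. -/
theorem Good.of_pattern {c : ColoredHypergraph I V} {d : ColoredHypergraph I W}
    (hd : d.Good sgn)
    (h : ∀ a : Fin 3 → V, ∃ b : Fin 3 → W, d.pattern b = c.pattern a) : c.Good sgn := by
  have key : ∀ x y z : V, ∃ x' y' z' : W, d.pattern ![x', y', z'] = c.pattern ![x, y, z] := by
    intro x y z
    obtain ⟨b, hb⟩ := h ![x, y, z]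
    exact ⟨b 0, b 1, b 2, by rw [← hb]; congr 1; ext i; fin_cases i <;> rfl⟩
  refine ⟨fun x y z H => ?_, fun i => ⟨fun x y H => ?_, fun x H => ?_⟩, fun i x y z h₁ h₂ h₃ => ?_⟩
  · obtain ⟨x', y', z', hp⟩ := key x y z
    obtain ⟨p₁, p₂, -⟩ := pattern_eq_iff.1 hp
    have := hd.hyper x' y' z' ((p₂ 0 1 2).2 H)
    exact ⟨⟨(p₂ 1 0 2).1 this.1.1, (p₂ 1 2 0).1 this.1.2⟩, mt (p₁ 0 1).2 this.2.1,
      mt (p₁ 1 2).2 this.2.2.1, mt (p₁ 0 2).2 this.2.2.2⟩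
  · obtain ⟨x', y', z', hp⟩ := key x y y
    obtain ⟨-, -, p₃⟩ := pattern_eq_iff.1 hp
    exact (p₃ i 1 0).1 ((hd.graph i).1 _ _ ((p₃ i 0 1).2 H))
  · obtain ⟨x', y', z', hp⟩ := key x x x
    obtain ⟨-, -, p₃⟩ := pattern_eq_iff.1 hp
    exact (hd.graph i).2 _ ((p₃ i 0 0).2 H)
  · obtain ⟨x', y', z', hp⟩ := key x y z
    obtain ⟨-, p₂, p₃⟩ := pattern_eq_iff.1 hp
    exact (p₂ 0 1 2).symm.trans
      (hd.triangle i _ _ _ ((p₃ i 0 1).2 h₁) ((p₃ i 1 2).2 h₂) ((p₃ i 2 0).2 h₃))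

theorem Good.comap {c : ColoredHypergraph I V} (h : c.Good sgn) {f : α → V}
    (hf : Function.Injective f) : (c.comap f).Good sgn :=
  h.of_pattern fun a => ⟨f ∘ a, pattern_eq_iff.2
    ⟨fun _ _ => hf.eq_iff, fun _ _ _ => Iff.rfl, fun _ _ _ => Iff.rfl⟩⟩

theorem Good.reduct {c : ColoredHypergraph I V} (h : c.Good sgn) (e : J → I) :
    (c.reduct e).Good (sgn ∘ e) :=
  ⟨h.hyper, fun j => h.graph (e j), fun j => h.triangle (e j)⟩

/-- The edges and hyperedges prescribed by `e` and `r` between a new vertex and the vertices in `A`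
define an extension which is again good. -/
structure IsExtensionType (sgn : I → Prop) (c : ColoredHypergraph I V) (A : Set V)
    (e : I → V → Prop) (r : V → V → Prop) : Prop where
  symm : ∀ a ∈ A, ∀ b ∈ A, r a b → r b a ∧ a ≠ b
  triangle : ∀ i, ∀ a ∈ A, ∀ b ∈ A, e i a → e i b → c.E i a b → (r a b ↔ sgn i)

/-- A good coloured hypergraph is generic if all extension types over finite sets are realized. -/
structure Generic (sgn : I → Prop) (c : ColoredHypergraph I V) : Prop where
  good : c.Good sgn
  extend : ∀ A : Set V, A.Finite → ∀ (e : I → V → Prop) (r : V → V → Prop),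
    IsExtensionType sgn c A e r → ∃ x, x ∉ A ∧ (∀ i, ∀ a ∈ A, c.E i x a ↔ e i a) ∧
      ∀ a ∈ A, ∀ b ∈ A, c.R x a b ↔ r a b

theorem Generic.reduct {c : ColoredHypergraph I V} (h : c.Generic sgn) {e : J → I}
    (he : Function.Injective e) : (c.reduct e).Generic (sgn ∘ e) := by
  refine ⟨h.good.reduct e, fun A hA ε r hr => ?_⟩
  -- The forgotten colours get no edges at the new vertex, so their rules hold vacuously there.
  obtain ⟨x, hxA, hE, hR⟩ := h.extend A hA (fun i a => ∃ j, e j = i ∧ ε j a) r ⟨hr.symm, by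
    rintro i a ha b hb ⟨j, rfl, hja⟩ ⟨k, hk, hkb⟩ hab
    obtain rfl := he hk
    exact hr.triangle k a ha b hb hja hkb hab⟩
  refine ⟨x, hxA, fun j a ha => (hE (e j) a ha).trans ⟨?_, fun H => ⟨j, rfl, H⟩⟩, hR⟩
  rintro ⟨k, hk, H⟩
  obtain rfl := he hk
  exact H

theorem pattern_option {c : ColoredHypergraph I V} {d : ColoredHypergraph I W} (hc : c.Good sgn)
    (hd : d.Good sgn) {f : α → V} {g : α → W} (h : c.pattern f = d.pattern g) {x : V} {y : W}
    (hx : x ∉ Set.range f) (hy : y ∉ Set.range g) (hE : ∀ i s, c.E i x (f s) ↔ d.E i y (g s))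
    (hR : ∀ s t, c.R x (f s) (f t) ↔ d.R y (g s) (g t)) :
    c.pattern (fun o : Option α => o.elim x f) = d.pattern (fun o : Option α => o.elim y g) := by
  rw [pattern_eq_iff] at h ⊢
  obtain ⟨p₁, p₂, p₃⟩ := h
  have hx' : ∀ s, f s ≠ x := fun s hs => hx ⟨s, hs⟩
  have hy' : ∀ s, g s ≠ y := fun s hs => hy ⟨s, hs⟩
  have nR : ∀ {U : Type} {b : ColoredHypergraph I U}, b.Good sgn → ∀ u v w, b.R u v w →
    u ≠ v ∧ v ≠ w ∧ u ≠ w := fun hb u v w H => (hb.hyper u v w H).2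
  refine ⟨?_, ?_, ?_⟩
  · rintro (_ | s) (_ | t)
    · simp
    · simpa using iff_of_false (hx' t).symm (hy' t).symm
    · simpa using iff_of_false (hx' s) (hy' s)
    · exact p₁ s t
  · rintro (_ | s) (_ | t) (_ | u)
    · exact iff_of_false (fun H => (nR hc _ _ _ H).1 rfl) fun H => (nR hd _ _ _ H).1 rfl
    · exact iff_of_false (fun H => (nR hc _ _ _ H).1 rfl) fun H => (nR hd _ _ _ H).1 rfl
    · exact iff_of_false (fun H => (nR hc _ _ _ H).2.2 rfl) fun H => (nR hd _ _ _ H).2.2 rfl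
    · exact hR t u
    · exact iff_of_false (fun H => (nR hc _ _ _ H).2.1 rfl) fun H => (nR hd _ _ _ H).2.1 rfl
    · exact hc.R_swap.trans ((hR s u).trans hd.R_swap)
    · exact (hc.R_rotate.trans hc.R_rotate).trans
        ((hR s t).trans (hd.R_rotate.trans hd.R_rotate).symm)
    · exact p₂ s t u
  · rintro i (_ | s) (_ | t)
    · exact iff_of_false ((hc.graph i).2 _) ((hd.graph i).2 _)
    · exact hE i t
    · exact hc.E_symm.trans ((hE i s).trans hd.E_symm)
    · exact p₃ i s t

/-- The finite set `B` to be avoided is what later makes algebraic closure trivial. -/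
theorem Generic.exists_extension {c : ColoredHypergraph I V} {d : ColoredHypergraph I W}
    (hc : c.Good sgn) (hd : d.Generic sgn) [Finite α] {f : α → V} {g : α → W}
    (h : c.pattern f = d.pattern g) (x : V) {B : Set W} (hB : B.Finite) :
    ∃ y, c.pattern (fun o : Option α => o.elim x f) = d.pattern (fun o : Option α => o.elim y g) ∧
      (x ∉ Set.range f → y ∉ B) := by
  by_cases hx : x ∈ Set.range f
  · obtain ⟨s, rfl⟩ := hx
    refine ⟨g s, ?_, fun H => (H ⟨s, rfl⟩).elim⟩
    have := pattern_comp h (fun o : Option α => o.elim s id)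
    have key : ∀ {U : Type} (k : α → U),
        k ∘ (fun o : Option α => o.elim s id) = fun o => o.elim (k s) k := by
      intro U k; funext o; cases o <;> rfl
    rwa [key, key] at this
  · obtain ⟨p₁, p₂, p₃⟩ := pattern_eq_iff.1 h
    -- The relations of `x` to `f` are transported to `g`. They are stated through preimages because
    -- `g` may repeat values; equality of patterns makes the choice of preimage irrelevant.
    obtain ⟨y, hyB, hE, hR⟩ := hd.extend (Set.range g ∪ B) ((Set.finite_range g).union hB)
      (fun i b => ∃ s, g s = b ∧ c.E i x (f s))
      (fun a b => ∃ s t, g s = a ∧ g t = b ∧ c.R x (f s) (f t)) ⟨by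
        rintro _ - _ - ⟨s, t, rfl, rfl, H⟩
        exact ⟨⟨t, s, rfl, rfl, hc.R_rotate.1 (hc.R_rotate.1 (hc.R_swap.1 (hc.R_rotate.1 H)))⟩,
          fun hst => (hc.hyper _ _ _ H).2.2.1 ((p₁ s t).2 hst)⟩, by
        rintro i _ - _ - ⟨s, rfl, hs⟩ ⟨t, rfl, ht⟩ hst
        rw [← hc.triangle i x (f s) (f t) hs ((p₃ i s t).2 hst) (hc.E_symm.1 ht)]
        constructor
        · rintro ⟨s', t', hs', ht', H⟩
          rwa [← (p₁ s' s).2 hs', ← (p₁ t' t).2 ht']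
        · exact fun H => ⟨s, t, rfl, rfl, H⟩⟩
    refine ⟨y, ?_, fun _ hy => hyB (Or.inr hy)⟩
    refine pattern_option hc hd.good h hx (fun hy => hyB (Or.inl hy)) (fun i s => ?_)
      fun s t => ?_
    · rw [hE i (g s) (Or.inl ⟨s, rfl⟩)]
      refine ⟨fun H => ⟨s, rfl, H⟩, ?_⟩
      rintro ⟨s', hs', H⟩
      rwa [← (p₁ s' s).2 hs']
    · rw [hR (g s) (Or.inl ⟨s, rfl⟩) (g t) (Or.inl ⟨t, rfl⟩)]
      refine ⟨fun H => ⟨s, t, rfl, rfl, H⟩, ?_⟩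
      rintro ⟨s', t', hs', ht', H⟩
      rwa [← (p₁ s' s).2 hs', ← (p₁ t' t).2 ht']

/-- Finite good extensions of finite subsets of a generic structure are realized. -/
theorem Generic.exists_embedding_extending {c : ColoredHypergraph I V}
    {d : ColoredHypergraph I W} (hc : c.Good sgn) (hd : d.Generic sgn) [Finite α] [Finite V]
    {f : α → V} {g : α → W} (h : c.pattern f = d.pattern g) :
    ∃ G : V → W, c.pattern id = d.pattern G ∧ G ∘ f = g := by
  classical
  have key : ∀ s : Set V, s.Finite → ∃ G : s → W,
      c.pattern (Sum.elim f (fun v : s => (v : V))) = d.pattern (Sum.elim g G) := by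
    intro s hs
    induction s, hs using Set.Finite.induction_on with
    | empty =>
      refine ⟨fun v => (v.2 : False).elim, ?_⟩
      have := pattern_comp h (Sum.elim id (fun v : (∅ : Set V) => (v.2 : False).elim))
      convert this using 2 <;> funext o <;> rcases o with o | ⟨v, hv⟩ <;> first | rfl | exact hv.elim
    | @insert v s hv hs ih =>
      obtain ⟨G, hG⟩ := ih
      have := hs.to_subtype
      obtain ⟨y, hy, -⟩ := hd.exists_extension hc hG v Set.finite_empty
      let e : α ⊕ (insert v s : Set V) → Option (α ⊕ s) :=
        Sum.elim (fun a => some (Sum.inl a)) fun u =>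
          if hu : u.1 ∈ s then some (Sum.inr ⟨u.1, hu⟩) else none
      have h' := pattern_comp hy e
      refine ⟨fun u => (e (Sum.inr u)).elim y (Sum.elim g G), ?_⟩
      convert h' using 2
      · funext o
        rcases o with a | ⟨u, hu⟩
        · rfl
        · by_cases hus : u ∈ s
          · simp [e, hus]
          · simpa [e, hus] using hu
      · funext o
        rcases o with a | ⟨u, hu⟩ <;> rfl
  obtain ⟨G, hG⟩ := key Set.univ Set.finite_univ
  refine ⟨fun v => G ⟨v, trivial⟩, pattern_comp hG (fun v => Sum.inr ⟨v, trivial⟩), ?_⟩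
  funext a
  exact ((pattern_eq_iff.1 hG).1 (Sum.inr ⟨f a, trivial⟩) (Sum.inl a)).1 rfl

/-! ### Existence of a generic structure -/

/-- The vertex `n` added to the restriction of `c` to `{0, …, n - 1}`. -/
def addVertex (c : ColoredHypergraph I ℕ) (n : ℕ) (e : I → ℕ → Prop) (r : ℕ → ℕ → Prop) :
    ColoredHypergraph I ℕ where
  R a b d := (a < n ∧ b < n ∧ d < n ∧ c.R a b d) ∨ (a = n ∧ b < n ∧ d < n ∧ r b d) ∨
    (b = n ∧ a < n ∧ d < n ∧ r a d) ∨ (d = n ∧ a < n ∧ b < n ∧ r a b)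
  E i a b := (a < n ∧ b < n ∧ c.E i a b) ∨ (a = n ∧ b < n ∧ e i b) ∨ (b = n ∧ a < n ∧ e i a)

theorem Good.addVertex {c : ColoredHypergraph I ℕ} (hc : c.Good sgn) {n : ℕ}
    {e : I → ℕ → Prop} {r : ℕ → ℕ → Prop} (h : IsExtensionType sgn c (Set.Iio n) e r) :
    (c.addVertex n e r).Good sgn := by
  have hs : ∀ a b, a < n → b < n → r a b → r b a ∧ a ≠ b := fun a b ha hb => h.symm a ha b hb
  refine ⟨?_, fun i => ⟨?_, ?_⟩, ?_⟩
  · rintro a b d (⟨ha, hb, hd, H⟩ | ⟨rfl, hb, hd, H⟩ | ⟨rfl, ha, hd, H⟩ | ⟨rfl, ha, hb, H⟩)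
    · have := hc.hyper _ _ _ H
      exact ⟨⟨Or.inl ⟨hb, ha, hd, this.1.1⟩, Or.inl ⟨hb, hd, ha, this.1.2⟩⟩, this.2⟩
    · exact ⟨⟨Or.inr (Or.inr (Or.inl ⟨rfl, hb, hd, H⟩)),
        Or.inr (Or.inr (Or.inr ⟨rfl, hb, hd, H⟩))⟩, by omega, (hs _ _ hb hd H).2, by omega⟩
    · exact ⟨⟨Or.inr (Or.inl ⟨rfl, ha, hd, H⟩), Or.inr (Or.inl ⟨rfl, hd, ha, (hs _ _ ha hd H).1⟩)⟩,
        by omega, by omega, (hs _ _ ha hd H).2⟩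
    · exact ⟨⟨Or.inr (Or.inr (Or.inr ⟨rfl, hb, ha, (hs _ _ ha hb H).1⟩)),
        Or.inr (Or.inr (Or.inl ⟨rfl, hb, ha, (hs _ _ ha hb H).1⟩))⟩, (hs _ _ ha hb H).2, by omega,
        by omega⟩
  · rintro a b (⟨ha, hb, H⟩ | ⟨rfl, hb, H⟩ | ⟨rfl, ha, H⟩)
    · exact Or.inl ⟨hb, ha, (hc.graph i).1 _ _ H⟩
    · exact Or.inr (Or.inr ⟨rfl, hb, H⟩)
    · exact Or.inr (Or.inl ⟨rfl, ha, H⟩)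
  · rintro a (⟨ha, hb, H⟩ | ⟨rfl, hb, H⟩ | ⟨rfl, ha, H⟩)
    · exact (hc.graph i).2 _ H
    · omega
    · omega
  · have tri : ∀ i a b, a < n → b < n → e i a → e i b → c.E i a b → (r a b ↔ sgn i) :=
      fun i a b ha hb => h.triangle i a ha b hb
    -- Of the 27 cases four survive: all three vertices are old, or exactly one of them is `n`.
    rintro i x y z (⟨hx, hy, h₁⟩ | ⟨rfl, hy, h₁⟩ | ⟨rfl, hx, h₁⟩)
      (⟨hy', hz, h₂⟩ | ⟨hy', hz, h₂⟩ | ⟨hz, hy', h₂⟩) (⟨hz', hx', h₃⟩ | ⟨hz', hx', h₃⟩ | ⟨hx', hz', h₃⟩)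
      <;> try omega
    · rw [← hc.triangle i x y z h₁ h₂ h₃]
      simp [ColoredHypergraph.addVertex, hx, hy, hz, hx.ne, hy.ne, hz.ne]
    · subst hz'
      rw [← tri i x y hx hy h₃ h₂ h₁]
      simp [ColoredHypergraph.addVertex, hx, hy, hx.ne, hy.ne]
    · rw [← tri i y z hy hz h₁ h₃ h₂]
      simp [ColoredHypergraph.addVertex, hz, hy, hz.ne, hy.ne]
    · rw [← tri i x z hx hz h₁ h₂ (hc.E_symm.1 h₃)]
      simp [ColoredHypergraph.addVertex, hx, hz, hx.ne, hz.ne]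

theorem exists_generic (sgn : I → Prop) [Finite I] :
    ∃ c : ColoredHypergraph I ℕ, c.Generic sgn := by
  classical
  have := Fintype.ofFinite I
  -- An enumeration of all finite requests (neighbours in each colour, pairs forming a hyperedge).
  -- The spare factor `ℕ` makes each request recur at arbitrarily late stages, after all vertices it
  -- mentions exist.
  obtain ⟨t, ht⟩ := exists_surjective_nat (((I → Finset ℕ) × Finset (ℕ × ℕ)) × ℕ)
  have ht' : ∀ τ k, ∃ n, k ≤ n ∧ (t n).1 = τ := by
    intro τ k
    by_contra! H
    have hsub : ∀ m, m ∈ (Finset.range k).image (fun n => (t n).2) := by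
      intro m
      obtain ⟨n, hn⟩ := ht (τ, m)
      refine Finset.mem_image.2 ⟨n, Finset.mem_range.2 ?_, by rw [hn]⟩
      by_contra hk
      exact H n (by omega) (by rw [hn])
    obtain ⟨m, hm⟩ := Infinite.exists_notMem_finset ((Finset.range k).image (fun n => (t n).2))
    exact hm (hsub m)
  let ε : ℕ → I → ℕ → Prop := fun n i a => a ∈ (t n).1.1 i
  let ρ : ℕ → ℕ → ℕ → Prop := fun n a b => (a, b) ∈ (t n).1.2
  -- If the request at stage `n` is not legitimate, then `P` fails and `n` is added as an isolated
  -- vertex.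
  let P : ColoredHypergraph I ℕ → ℕ → Prop :=
    fun c n => IsExtensionType sgn c (Set.Iio n) (ε n) (ρ n)
  let seq : ℕ → ColoredHypergraph I ℕ := fun n => Nat.rec
    ⟨fun _ _ _ => False, fun _ _ _ => False⟩ (fun n c =>
      c.addVertex n (fun i a => P c n ∧ ε n i a) fun a b => P c n ∧ ρ n a b) n
  have seq_succ : ∀ n, seq (n + 1) = (seq n).addVertex n (fun i a => P (seq n) n ∧ ε n i a)
    fun a b => P (seq n) n ∧ ρ n a b := fun n => rfl
  have good : ∀ n, (seq n).Good sgn := by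
    intro n
    induction n with
    | zero => exact ⟨fun _ _ _ h => h.elim, fun i => ⟨fun _ _ h => h.elim, fun _ h => h⟩,
        fun _ _ _ _ h => h.elim⟩
    | succ n ih =>
      rw [seq_succ]
      refine ih.addVertex ⟨?_, ?_⟩
      · rintro a ha b hb ⟨h, H⟩
        exact ⟨⟨h, (h.symm a ha b hb H).1⟩, (h.symm a ha b hb H).2⟩
      · rintro i a ha b hb ⟨h, h₁⟩ ⟨-, h₂⟩ h₃
        simpa [h] using h.triangle i a ha b hb h₁ h₂ h₃
  have stepE : ∀ n i a b, a < n → b < n → ((seq (n + 1)).E i a b ↔ (seq n).E i a b) := by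
    intro n i a b ha hb
    simp [seq_succ, addVertex, ha, hb, ha.ne, hb.ne]
  have stepR : ∀ n a b d, a < n → b < n → d < n →
      ((seq (n + 1)).R a b d ↔ (seq n).R a b d) := by
    intro n a b d ha hb hd
    simp [seq_succ, addVertex, ha, hb, hd, ha.ne, hb.ne, hd.ne]
  have leE : ∀ n m, n ≤ m → ∀ i a b, a < n → b < n → ((seq m).E i a b ↔ (seq n).E i a b) := by
    intro n m hnm i a b ha hb
    induction m, hnm using Nat.le_induction with
    | base => rfl
    | succ m hm ih => rw [stepE m i a b (by omega) (by omega), ih]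
  have leR : ∀ n m, n ≤ m → ∀ a b d, a < n → b < n → d < n →
      ((seq m).R a b d ↔ (seq n).R a b d) := by
    intro n m hnm a b d ha hb hd
    induction m, hnm using Nat.le_induction with
    | base => rfl
    | succ m hm ih => rw [stepR m a b d (by omega) (by omega) (by omega), ih]
  -- The limit: relations among vertices below `n` never change after stage `n`, so they may be read
  -- off at any later stage.
  let c : ColoredHypergraph I ℕ :=
    ⟨fun a b d => (seq (a + b + d + 1)).R a b d, fun i a b => (seq (a + b + 1)).E i a b⟩
  have cE : ∀ n i a b, a < n → b < n → (c.E i a b ↔ (seq n).E i a b) := by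
    intro n i a b ha hb
    rcases le_total n (a + b + 1) with h | h
    · exact leE _ _ h i a b ha hb
    · exact (leE _ _ h i a b (by omega) (by omega)).symm
  have cR : ∀ n a b d, a < n → b < n → d < n → (c.R a b d ↔ (seq n).R a b d) := by
    intro n a b d ha hb hd
    rcases le_total n (a + b + d + 1) with h | h
    · exact leR _ _ h a b d ha hb hd
    · exact (leR _ _ h a b d (by omega) (by omega) (by omega)).symm
  refine ⟨c, ⟨?_, ?_, ?_⟩, ?_⟩
  · intro x y z H
    have := (good (x + y + z + 1)).hyper x y z H
    refine ⟨⟨?_, ?_⟩, this.2⟩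
    · exact (cR (x + y + z + 1) _ _ _ (by omega) (by omega) (by omega)).2 this.1.1
    · exact (cR (x + y + z + 1) _ _ _ (by omega) (by omega) (by omega)).2 this.1.2
  · refine fun i => ⟨fun x y H => ?_, fun x H => ((good (x + x + 1)).graph i).2 x H⟩
    exact (cE (x + y + 1) i _ _ (by omega) (by omega)).2 (((good (x + y + 1)).graph i).1 x y H)
  · intro i x y z h₁ h₂ h₃
    rw [cE (x + y + z + 1) i _ _ (by omega) (by omega)] at h₁ h₂ h₃
    rw [cR (x + y + z + 1) _ _ _ (by omega) (by omega) (by omega)]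
    exact (good (x + y + z + 1)).triangle i x y z h₁ h₂ h₃
  · intro A hA e r h
    obtain ⟨B, rfl⟩ := hA.exists_finset_coe
    obtain ⟨k, hk⟩ : ∃ k, ∀ a ∈ B, a < k := ⟨B.sup id + 1, fun a ha =>
      Nat.lt_succ_of_le (Finset.le_sup (f := id) ha)⟩
    obtain ⟨n, hkn, hn⟩ := ht' (fun i => B.filter (e i), (B ×ˢ B).filter fun p => r p.1 p.2) k
    have hε : ∀ i a, ε n i a ↔ a ∈ B ∧ e i a := fun i a => by simp [ε, hn]
    have hρ : ∀ a b, ρ n a b ↔ (a ∈ B ∧ b ∈ B) ∧ r a b := fun a b => by simp [ρ, hn]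
    have hB : ∀ a ∈ B, a < n := fun a ha => (hk a ha).trans_le hkn
    have hP : P (seq n) n := by
      refine ⟨fun a _ b _ H => ?_, fun i a _ b _ h₁ h₂ h₃ => ?_⟩
      · rw [hρ] at H ⊢
        have := h.symm a H.1.1 b H.1.2 H.2
        exact ⟨⟨H.1.symm, this.1⟩, this.2⟩
      · rw [hε] at h₁ h₂
        rw [hρ, ← h.triangle i a h₁.1 b h₂.1 h₁.2 h₂.2
          ((cE n i a b (hB a h₁.1) (hB b h₂.1)).2 h₃)]
        simp [h₁.1, h₂.1]
    refine ⟨n, fun hnB => lt_irrefl n (hB n hnB), fun i a ha => ?_, fun a ha b hb => ?_⟩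
    · have ha' := hB a ha
      rw [cE (n + 1) i n a (by omega) (by omega), seq_succ]
      simp [addVertex, ha', ha'.ne, hP, hε, Finset.mem_coe.1 ha]
    · have ha' := hB a ha
      have hb' := hB b hb
      rw [cR (n + 1) n a b (by omega) (by omega) (by omega), seq_succ]
      simp [addVertex, ha', ha'.ne, hb', hb'.ne, hP, hρ, Finset.mem_coe.1 ha, Finset.mem_coe.1 hb]

end ColoredHypergraph

/-! ## Languages of coloured hypergraphs -/

/-- The relation symbols of coloured hypergraphs. -/
inductive ColoredSymbol (I : Type) : ℕ → Type
  | hyper : ColoredSymbol I 3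
  | edge (i : I) : ColoredSymbol I 2

/-- The interpretation of the relation symbols in a coloured hypergraph. -/
def ColoredHypergraph.Holds {I V : Type} (c : ColoredHypergraph I V) :
    ∀ {k : ℕ}, ColoredSymbol I k → (Fin k → V) → Prop
  | _, .hyper, v => c.R (v 0) (v 1) (v 2)
  | _, .edge i, v => c.E i (v 0) (v 1)

/-- A relational language whose symbols are those of hypergraphs with edges coloured by `I`. -/
class ColoredLanguage (L : FirstOrder.Language.{0, 0}) (I : outParam Type) where
  relational : L.IsRelational
  /-- The identification of the relation symbols. -/
  symbols : ∀ k, L.Relations k ≃ ColoredSymbol I k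

namespace ColoredLanguage

open Structure AtomicTypes ColoredHypergraph

instance : ColoredLanguage hypergraphLanguage Empty where
  relational := inferInstance
  symbols k :=
    { toFun := fun r => match k, r with
        | _, .edge => .hyper
      invFun := fun r => match k, r with
        | _, .hyper => .edge
        | _, .edge i => i.elim
      left_inv := by rintro ⟨⟩; rfl
      right_inv := by rintro (_ | ⟨⟨⟩⟩); rfl }

instance : ColoredLanguage expandedLanguage Unit where
  relational := inferInstance
  symbols k :=
    { toFun := fun r => match k, r with
        | _, .inl .edge => .hyper
        | _, .inr .adj => .edge ()
      invFun := fun r => match k, r with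
        | _, .hyper => .inl .edge
        | _, .edge _ => .inr .adj
      left_inv := by rintro (⟨⟨⟩⟩ | ⟨⟨⟩⟩) <;> rfl
      right_inv := by rintro (_ | _) <;> rfl }

instance : ColoredLanguage (unionLanguage hypergraphLanguage extraSymbols) (Fin 2) where
  relational := fun _ => ⟨fun f => by
    rcases f with f | ⟨_, f⟩
    · exact f.elim
    · exact f.elim⟩
  symbols k :=
    { toFun := fun r => match k, r with
        | _, .inl .edge => .hyper
        | _, .inr ⟨i, .adj⟩ => .edge i
      invFun := fun r => match k, r with
        | _, .hyper => .inl .edge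
        | _, .edge i => .inr ⟨i, .adj⟩
      left_inv := by rintro (⟨⟨⟩⟩ | ⟨i, ⟨⟩⟩) <;> rfl
      right_inv := by rintro (_ | _) <;> rfl }

variable {L : FirstOrder.Language.{0, 0}} {I : Type} [ColoredLanguage L I] {sgn : I → Prop}

instance isRelational : L.IsRelational := ColoredLanguage.relational

instance isEmpty_relations_zero : IsEmpty (L.Relations 0) :=
  ⟨fun r => nomatch symbols 0 r⟩

instance finite_relations [Finite I] : Finite (Σ k, L.Relations k) := by
  refine Finite.of_surjective (fun o : Option I => o.elim
    (⟨3, (symbols 3).symm .hyper⟩ : Σ k, L.Relations k) fun i => ⟨2, (symbols 2).symm (.edge i)⟩) ?_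
  rintro ⟨k, r⟩
  obtain ⟨s, rfl⟩ := (symbols k).symm.surjective r
  cases s with
  | hyper => exact ⟨none, rfl⟩
  | edge i => exact ⟨some i, rfl⟩

variable (L) in
/-- The coloured hypergraph given by a structure. -/
def toColored (M : Type) [L.Structure M] : ColoredHypergraph I M :=
  ⟨fun a b c => RelMap ((symbols (L := L) 3).symm .hyper) ![a, b, c],
    fun i a b => RelMap ((symbols (L := L) 2).symm (.edge i)) ![a, b]⟩

variable (L) in
/-- The structure given by a coloured hypergraph. -/
@[reducible]
def ofColored {V : Type} (c : ColoredHypergraph I V) : L.Structure V where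
  funMap f := isEmptyElim f
  RelMap r v := c.Holds (symbols _ r) v

theorem toColored_ofColored {V : Type} (c : ColoredHypergraph I V) :
    letI := ofColored L c
    toColored L V = c := by
  have h : ∀ {k : ℕ} (s : ColoredSymbol I k) (v : Fin k → V),
      @RelMap L V (ofColored L c) k ((symbols k).symm s) v = c.Holds s v := by
    intro k s v
    change c.Holds (symbols k ((symbols k).symm s)) v = c.Holds s v
    rw [Equiv.apply_symm_apply]
  cases c
  simp only [toColored, h]
  rfl

theorem relMap_iff {M : Type} [L.Structure M] {k : ℕ} (r : L.Relations k) (v : Fin k → M) :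
    RelMap r v ↔ (toColored L M).Holds (symbols k r) v := by
  obtain ⟨s, rfl⟩ := (symbols k).symm.surjective r
  rw [Equiv.apply_symm_apply]
  cases s with
  | hyper =>
    simp only [Holds, toColored]
    rw [show ![v 0, v 1, v 2] = v by ext i; fin_cases i <;> rfl]
  | edge i =>
    simp only [Holds, toColored]
    rw [show ![v 0, v 1] = v by ext i; fin_cases i <;> rfl]

section

variable {M N V : Type} [L.Structure M] [L.Structure N] [L.Structure V] {α : Type}

theorem atomicType_eq_iff_pattern_eq {f : α → M} {g : α → N} :
    atomicType L f = atomicType L g ↔ (toColored L M).pattern f = (toColored L N).pattern g := by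
  rw [atomicType_eq_iff, pattern_eq_iff]
  refine and_congr Iff.rfl ⟨fun h => ⟨fun x y z => ?_, fun i x y => ?_⟩, ?_⟩
  · simpa [relMap_iff, Holds] using h 3 ((symbols 3).symm .hyper) ![x, y, z]
  · simpa [relMap_iff, Holds] using h 2 ((symbols 2).symm (.edge i)) ![x, y]
  · rintro ⟨h₁, h₂⟩ k r v
    rw [relMap_iff, relMap_iff]
    cases symbols k r with
    | hyper => exact h₁ _ _ _
    | edge i => exact h₂ i _ _

/-- Only the target has to be generic. Taking a finite good source gives the age of the Fraïssé
limit, and taking countable good sources embeds prescribed configurations. -/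
theorem backAndForth_of_generic (hV : (toColored L V).Good sgn)
    (hM : (toColored L M).Generic sgn) : BackAndForth L V M := by
  intro α _ f g h x
  rw [atomicType_eq_iff_pattern_eq] at h
  obtain ⟨y, hy, -⟩ := hM.exists_extension hV h x Set.finite_empty
  exact ⟨y, atomicType_eq_iff_pattern_eq.2 hy⟩

/-- Generic structures have quantifier elimination. -/
theorem realize_iff_of_pattern_eq (hM : (toColored L M).Generic sgn)
    (hN : (toColored L N).Generic sgn) [Finite α] (φ : L.Formula α) {v : α → M} {w : α → N}
    (h : (toColored L M).pattern v = (toColored L N).pattern w) : φ.Realize v ↔ φ.Realize w :=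
  formula_realize_iff_of_atomicType_eq (backAndForth_of_generic hM.good hN)
    (backAndForth_of_generic hN.good hM) φ (atomicType_eq_iff_pattern_eq.2 h)

theorem elementarilyEquivalent_of_generic (hM : (toColored L M).Generic sgn)
    (hN : (toColored L N).Generic sgn) : M ≅[L] N :=
  elementarilyEquivalent_of_backAndForth (backAndForth_of_generic hM.good hN)
    (backAndForth_of_generic hN.good hM)

theorem good_of_embedding (hM : (toColored L M).Good sgn) (f : V ↪[L] M) :
    (toColored L V).Good sgn :=
  hM.of_pattern fun a =>
    ⟨f ∘ a, atomicType_eq_iff_pattern_eq.1 (atomicType_embedding_comp f a)⟩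

/-- This makes genericity an elementary class without writing axioms: all models of the complete
theory of one generic structure are generic. -/
theorem generic_of_elementarilyEquivalent [Finite I] (hM : (toColored L M).Generic sgn)
    (h : M ≅[L] N) : (toColored L N).Generic sgn := by
  have hMN : BackAndForth L M N :=
    (backAndForth_of_generic hM.good hM).of_elementarilyEquivalent h
  have hgood : (toColored L N).Good sgn := hM.good.of_pattern fun a => by
    obtain ⟨b, hb⟩ := exists_atomicType_eq h a
    exact ⟨b, atomicType_eq_iff_pattern_eq.1 hb⟩
  refine ⟨hgood, fun A hA e r hr => ?_⟩
  have := hA.to_subtype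
  -- `A` is copied into `M`, the extension type is realized over the copy, and the realization is
  -- brought back to `N`.
  obtain ⟨g, hg⟩ := exists_atomicType_eq h (fun a : A => (a : N))
  obtain ⟨p₁, p₂, p₃⟩ := pattern_eq_iff.1 (atomicType_eq_iff_pattern_eq.1 hg)
  have inj : ∀ {a b : A}, g a = g b → a = b := fun h => Subtype.ext ((p₁ _ _).1 h)
  obtain ⟨x, hxA, hE, hR⟩ := hM.extend (Set.range g) (Set.finite_range g)
    (fun i b => ∃ a, g a = b ∧ e i a) (fun b d => ∃ a a' : A, g a = b ∧ g a' = d ∧ r a a') ⟨by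
      rintro _ - _ - ⟨a, b, rfl, rfl, H⟩
      have := hr.symm a a.2 b b.2 H
      exact ⟨⟨b, a, rfl, rfl, this.1⟩, fun hab => this.2 (by rw [inj hab])⟩, by
      rintro i _ - _ - ⟨a, rfl, ha⟩ ⟨b, rfl, hb⟩ hab
      rw [← hr.triangle i a a.2 b b.2 ha hb ((p₃ i a b).1 hab)]
      refine ⟨?_, fun H => ⟨a, b, rfl, rfl, H⟩⟩
      rintro ⟨a', b', ha', hb', H⟩
      rwa [← inj ha', ← inj hb']⟩
  obtain ⟨y, hy⟩ := hMN A g (fun a => (a : N)) hg x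
  obtain ⟨q₁, q₂, q₃⟩ := pattern_eq_iff.1 (atomicType_eq_iff_pattern_eq.1 hy)
  refine ⟨y, fun hyA => hxA ⟨⟨y, hyA⟩, ((q₁ none (some ⟨y, hyA⟩)).2 rfl).symm⟩,
    fun i a ha => ?_, fun a ha b hb => ?_⟩
  · refine (q₃ i none (some ⟨a, ha⟩)).symm.trans ((hE i _ ⟨_, rfl⟩).trans ?_)
    refine ⟨?_, fun H => ⟨⟨a, ha⟩, rfl, H⟩⟩
    rintro ⟨a', ha', H⟩
    rwa [inj ha'] at H
  · refine (q₂ none (some ⟨a, ha⟩) (some ⟨b, hb⟩)).symm.trans ((hR _ ⟨_, rfl⟩ _ ⟨_, rfl⟩).trans ?_)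
    refine ⟨?_, fun H => ⟨⟨a, ha⟩, ⟨b, hb⟩, rfl, rfl, H⟩⟩
    rintro ⟨a', b', ha', hb', H⟩
    rwa [inj ha', inj hb'] at H

end

/-! ### The theory of generic structures -/

variable (L sgn) in
/-- A countable generic coloured hypergraph. -/
@[reducible]
noncomputable def genericStructure [Finite I] : L.Structure ℕ :=
  ofColored L (exists_generic sgn).choose

theorem generic_genericStructure [Finite I] :
    letI := genericStructure L sgn
    (toColored L ℕ).Generic sgn := by
  have := (exists_generic sgn).choose_spec
  rwa [← toColored_ofColored (L := L) (exists_generic sgn).choose] at this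

variable (L sgn) in
/-- The theory of generic coloured hypergraphs. -/
noncomputable def genericTheory [Finite I] : L.Theory :=
  letI := genericStructure L sgn
  L.completeTheory ℕ

theorem model_genericTheory_iff [Finite I] {M : Type} [L.Structure M] :
    M ⊨ genericTheory L sgn ↔ (toColored L M).Generic sgn := by
  let := genericStructure L sgn
  have hg : (toColored L ℕ).Generic sgn := generic_genericStructure
  constructor
  · intro h
    have h' : M ⊨ L.completeTheory ℕ := h
    exact generic_of_elementarilyEquivalent hg
      (elementarilyEquivalent_iff.2 fun φ => (realize_iff_of_model_completeTheory ℕ M φ).symm)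
  · intro h
    have h' := elementarilyEquivalent_of_generic hg h
    exact h'.theory_model_iff.1 model_completeTheory

theorem genericTheory_eq_completeTheory [Finite I] {M : Type} [L.Structure M]
    (hM : (toColored L M).Generic sgn) : genericTheory L sgn = L.completeTheory M := by
  let := genericStructure L sgn
  exact elementarilyEquivalent_of_generic generic_genericStructure hM

theorem exists_countable_generic (L : FirstOrder.Language.{0, 0}) {I : Type} [ColoredLanguage L I]
    [Finite I] (sgn : I → Prop) : ∃ _ : L.Structure ℕ, (toColored L ℕ).Generic sgn :=
  ⟨genericStructure L sgn, generic_genericStructure⟩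

theorem isAlephZeroCategorical_genericTheory [Finite I] :
    IsAlephZeroCategorical (genericTheory L sgn) := by
  refine ⟨?_, fun M N hM hN => ?_⟩
  · obtain ⟨_, h⟩ := exists_countable_generic L sgn
    have := model_genericTheory_iff.2 h
    exact ⟨Theory.ModelType.of _ ℕ, mk_nat⟩
  · have hM' := model_genericTheory_iff.1 M.is_model
    have hN' := model_genericTheory_iff.1 N.is_model
    have : Countable M := mk_le_aleph0_iff.1 hM.le
    have : Countable N := mk_le_aleph0_iff.1 hN.le
    exact exists_equiv_of_backAndForth (backAndForth_of_generic hM'.good hN')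
      (backAndForth_of_generic hN'.good hM')

theorem hasTrivialAcl_genericTheory [Finite I] : HasTrivialAcl (genericTheory L sgn) := by
  intro M A
  have hM := model_genericTheory_iff.1 M.is_model
  refine Set.Subset.antisymm ?_ fun a ha =>
    ⟨{a}, Set.Definable.singleton_of_mem _ ha, Set.finite_singleton a, rfl⟩
  rintro b ⟨S, hS, hfin, hb⟩
  by_contra hbA
  obtain ⟨A₀, hA₀, hS⟩ := Set.definable_iff_finitely_definable.1 hS
  obtain ⟨φ, hφ⟩ := Set.definable_iff_exists_formula_sum.1 hS
  -- If `b ∉ A`, its type over `A₀` is realized outside the finite set `S`; by quantifier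
  -- elimination this realization lies in `S`.
  obtain ⟨y, hy, hyS⟩ := hM.exists_extension hM.good
    (rfl : (toColored L M).pattern (fun a : A₀ => (a : M)) = _) b hfin
  refine hyS ?_ ?_
  · rintro ⟨a, rfl⟩
    exact hbA (hA₀ a.2)
  · have key : ∀ z : M, (fun o : Option A₀ => o.elim z fun a : A₀ => (a : M)) ∘
        (Sum.elim (fun a => some a) fun _ : Fin 1 => none) =
          Sum.elim (fun a : A₀ => (a : M)) (fun _ => z) := by
      intro z
      funext o
      rcases o with a | a <;> rfl
    have := pattern_comp hy (Sum.elim (fun a => some a) fun _ : Fin 1 => none)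
    rw [key, key] at this
    have mem : ∀ z : M, z ∈ S ↔ φ.Realize (Sum.elim (fun a : A₀ => (a : M)) (fun _ => z)) :=
      fun z => Set.ext_iff.1 hφ (fun _ => z)
    rw [mem, ← realize_iff_of_pattern_eq hM hM φ this, ← mem]
    exact hb

theorem isFraisseLimit_of_generic [Finite I] [Countable (Σ l, L.Functions l)]
    (K : Set (CategoryTheory.Bundled.{0} L.Structure)) {M : Type} [L.Structure M] [Countable M]
    (hM : (toColored L M).Generic sgn)
    (hK : ∀ V : CategoryTheory.Bundled.{0} L.Structure,
      V ∈ K ↔ Finite V ∧ (toColored L V).Good sgn) : IsFraisseLimit K M :=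
  isFraisseLimit_of_backAndForth K (backAndForth_of_generic hM.good hM)
    (fun V hV => ⟨((hK V).1 hV).1, backAndForth_of_generic ((hK V).1 hV).2 hM⟩)
    fun V hV f => (hK V).2 ⟨hV, good_of_embedding hM.good f⟩

theorem isTheoryOfFraisseLimit_genericTheory [Finite I] [Countable (Σ l, L.Functions l)]
    (K : Set (CategoryTheory.Bundled.{0} L.Structure))
    (hK : ∀ V : CategoryTheory.Bundled.{0} L.Structure,
      V ∈ K ↔ Finite V ∧ (toColored L V).Good sgn) :
    IsTheoryOfFraisseLimit K (genericTheory L sgn) := by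
  obtain ⟨s, h⟩ := exists_countable_generic L sgn
  exact ⟨ℕ, s, inferInstance, isFraisseLimit_of_generic K h hK, genericTheory_eq_completeTheory h⟩

/-! ### The three classes as classes of finite good hypergraphs -/

theorem mem_finiteHypergraphs_iff (V : CategoryTheory.Bundled.{0} hypergraphLanguage.Structure) :
    V ∈ finiteHypergraphs ↔
      Finite V ∧ (toColored hypergraphLanguage V).Good (fun i => i.elim) :=
  and_congr Iff.rfl ⟨fun h => ⟨h, fun i => i.elim, fun i => i.elim⟩, fun h => h.hyper⟩

theorem mem_classK₁_iff (V : CategoryTheory.Bundled.{0} expandedLanguage.Structure) :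
    V ∈ classK₁ ↔ Finite V ∧ (toColored expandedLanguage V).Good (fun _ => True) :=
  and_congr Iff.rfl
    ⟨fun h => ⟨h.1, fun _ => h.2.1, fun _ x y z h₁ h₂ h₃ => iff_true_intro (h.2.2 x y z h₁ h₂ h₃)⟩,
      fun h => ⟨h.hyper, h.graph (), fun x y z h₁ h₂ h₃ =>
        of_iff_true (h.triangle () x y z h₁ h₂ h₃)⟩⟩

theorem mem_classK₂_iff (V : CategoryTheory.Bundled.{0} expandedLanguage.Structure) :
    V ∈ classK₂ ↔ Finite V ∧ (toColored expandedLanguage V).Good (fun _ => False) :=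
  and_congr Iff.rfl
    ⟨fun h => ⟨h.1, fun _ => h.2.1, fun _ x y z h₁ h₂ h₃ => iff_false_intro (h.2.2 x y z h₁ h₂ h₃)⟩,
      fun h => ⟨h.hyper, h.graph (), fun x y z h₁ h₂ h₃ =>
        not_of_iff_false (h.triangle () x y z h₁ h₂ h₃)⟩⟩

end ColoredLanguage

/-! ## Simplicity -/

namespace ColoredHypergraph

variable {I M α β ι : Type} {sgn : I → Prop}

/-- If the tuples `b' i` have the isomorphism type of `b` and intersect each other only in a common
part, and `a` meets `b` only in that part, then some `a'` is related to each `b' i` as `a` is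
related to `b`. -/
theorem Generic.exists_simultaneous [Subsingleton I] [Finite α] [Finite β] [Finite ι]
    {c : ColoredHypergraph I M} (hc : c.Generic sgn) (a : α → M) (b : β → M) (b' : ι → β → M)
    (hb : ∀ i, c.pattern (b' i) = c.pattern b)
    (hk : ∀ i j s t, b' i s = b' j t → b s = b t)
    (ha : ∀ t s, a t = b s → ∀ i, b' i s = b s) :
    ∃ a' : α → M, ∀ i, c.pattern (Sum.elim a' (b' i)) = c.pattern (Sum.elim a b) := by
  classical
  let f : ι × β → M := fun p => b' p.1 p.2
  let Wb := Set.range f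
  -- Only these entries of `a` need new copies: by `ha`, an entry shared with `b` stays fixed in
  -- every `b' i`.
  let Wa : Set M := Set.range a \ Set.range b
  have hWa : ∀ (x : Wa) s, (x : M) ≠ b s := fun x s h => x.2.2 ⟨s, h.symm⟩
  -- `k` folds all copies back onto `b`, sending `b' i s` to `b s`; by `hk` this does not depend on
  -- the choice.
  let k : Wb → M := fun p => b p.2.choose.2
  have hks : ∀ i s, k ⟨b' i s, ⟨(i, s), rfl⟩⟩ = b s := by
    intro i s
    exact hk _ i _ s (Set.mem_range.1 (⟨(i, s), rfl⟩ : b' i s ∈ Wb)).choose_spec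
  -- Hyperedges between a new vertex and two old ones. Inside one copy they are those of `b`; across
  -- copies they take the truth value of the sign, so every triangle that arises obeys the rule.
  -- This is where a single colour is essential.
  let mix : M → Wb → Wb → Prop := fun x p q => p ≠ q ∧
    ((∃ i s t, b' i s = p ∧ b' i t = q ∧ c.R x (b s) (b t)) ∨
      ((¬ ∃ i s t, b' i s = p ∧ b' i t = q) ∧ ∃ j, sgn j))
  have hR₁ : ∀ {x y z}, c.R x y z ↔ c.R y x z := hc.good.R_swap
  have hR₂ : ∀ {x y z}, c.R x y z ↔ c.R y z x := hc.good.R_rotate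
  have hR₃ : ∀ {x y z}, c.R x y z ↔ c.R x z y := hR₂.trans (hR₁.trans (hR₂.trans (hR₂)))
  have mix_symm : ∀ {x p q}, mix x p q → mix x q p := by
    rintro x p q ⟨hpq, ⟨i, s, t, hs, ht, H⟩ | ⟨h, H⟩⟩
    · exact ⟨hpq.symm, Or.inl ⟨i, t, s, ht, hs, hR₃.1 H⟩⟩
    · refine ⟨hpq.symm, Or.inr ⟨?_, H⟩⟩
      rintro ⟨i, s, t, hs, ht⟩
      exact h ⟨i, t, s, ht, hs⟩
  have mix_iff : ∀ x i s t, mix x ⟨b' i s, ⟨(i, s), rfl⟩⟩ ⟨b' i t, ⟨(i, t), rfl⟩⟩ ↔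
      c.R x (b s) (b t) := by
    intro x i s t
    constructor
    · rintro ⟨-, ⟨j, s', t', hs, ht, H⟩ | ⟨h, -⟩⟩
      · rwa [← hk _ _ _ _ hs, ← hk _ _ _ _ ht]
      · exact (h ⟨i, s, t, rfl, rfl⟩).elim
    · intro H
      refine ⟨fun h => ?_, Or.inl ⟨i, s, t, rfl, rfl, H⟩⟩
      exact (hc.good.hyper _ _ _ H).2.2.1 (hk _ _ _ _ (congrArg Subtype.val h))
  have mix_tri : ∀ j x p q, c.E j x (k p) → c.E j x (k q) → c.E j p q → (mix x p q ↔ sgn j) := by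
    intro j x p q h₁ h₂ h₃
    by_cases h : ∃ i s t, b' i s = p ∧ b' i t = q
    · obtain ⟨i, s, t, hs, ht⟩ := h
      obtain rfl : (⟨b' i s, ⟨(i, s), rfl⟩⟩ : Wb) = p := Subtype.ext hs
      obtain rfl : (⟨b' i t, ⟨(i, t), rfl⟩⟩ : Wb) = q := Subtype.ext ht
      rw [mix_iff]
      rw [hks] at h₁ h₂
      exact hc.good.triangle j _ _ _ h₁ (((pattern_eq_iff.1 (hb i)).2.2 j s t).1 h₃)
        (hc.good.E_symm.1 h₂)
    · constructor
      · rintro ⟨-, ⟨i, s, t, hs, ht, -⟩ | ⟨-, j', hj'⟩⟩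
        · exact (h ⟨i, s, t, hs, ht⟩).elim
        · rwa [Subsingleton.elim j j']
      · intro hj
        refine ⟨?_, Or.inr ⟨h, j, hj⟩⟩
        rintro rfl
        exact (hc.good.graph j).2 _ h₃
  -- The amalgam keeps the actual relations on `Wb` and on `Wa`; genericity then embeds it over
  -- `Wb`.
  let d : ColoredHypergraph I (Wb ⊕ Wa) :=
    { R := fun u v w => match u, v, w with
        | .inl p, .inl q, .inl r => c.R p q r
        | .inr x, .inr y, .inr z => c.R x y z
        | .inr x, .inr y, .inl p => c.R x y (k p)
        | .inr x, .inl p, .inr y => c.R x y (k p)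
        | .inl p, .inr x, .inr y => c.R x y (k p)
        | .inr x, .inl p, .inl q => mix x p q
        | .inl p, .inr x, .inl q => mix x p q
        | .inl p, .inl q, .inr x => mix x p q
      E := fun i u v => match u, v with
        | .inl p, .inl q => c.E i p q
        | .inr x, .inr y => c.E i x y
        | .inr x, .inl p => c.E i x (k p)
        | .inl p, .inr x => c.E i x (k p) }
  have hd : d.Good sgn := by
    refine ⟨?_, fun i => ⟨?_, ?_⟩, fun i => ?_⟩
    · have ne : ∀ {x y z}, c.R x y z → x ≠ y ∧ y ≠ z ∧ x ≠ z := fun H => (hc.good.hyper _ _ _ H).2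
      rintro (p | x) (q | y) (r | z) H
      · exact ⟨⟨hR₁.1 H, hR₂.1 H⟩, by simpa [← Subtype.coe_inj] using ne H⟩
      · exact ⟨⟨mix_symm H, mix_symm H⟩, by simpa using H.1⟩
      · exact ⟨⟨H, mix_symm H⟩, by simpa using H.1⟩
      · exact ⟨⟨H, H⟩, by simpa [← Subtype.coe_inj] using (ne H).1⟩
      · exact ⟨⟨H, H⟩, by simpa using H.1⟩
      · exact ⟨⟨H, hR₁.1 H⟩, by simpa [← Subtype.coe_inj] using (ne H).1⟩
      · exact ⟨⟨hR₁.1 H, hR₁.1 H⟩, by simpa [← Subtype.coe_inj] using (ne H).1⟩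
      · exact ⟨⟨hR₁.1 H, hR₂.1 H⟩, by simpa [← Subtype.coe_inj] using ne H⟩
    · rintro (p | x) (q | y) H
      · exact (hc.good.graph i).1 _ _ H
      · exact H
      · exact H
      · exact (hc.good.graph i).1 _ _ H
    · rintro (p | x) H
      · exact (hc.good.graph i).2 _ H
      · exact (hc.good.graph i).2 _ H
    · have sy : ∀ {x y}, c.E i x y → c.E i y x := fun H => hc.good.E_symm.1 H
      rintro (p | x) (q | y) (r | z) h₁ h₂ h₃
      · exact hc.good.triangle i _ _ _ h₁ h₂ h₃
      · exact mix_tri i z p q h₃ h₂ h₁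
      · exact mix_tri i y p r h₁ h₂ (sy h₃)
      · exact hc.good.triangle i _ _ _ h₂ h₃ (sy h₁)
      · exact mix_tri i x q r h₁ h₃ h₂
      · exact hc.good.triangle i _ _ _ (sy h₃) h₂ (sy h₁)
      · exact hc.good.triangle i _ _ _ h₁ h₂ (sy h₃)
      · exact hc.good.triangle i _ _ _ h₁ h₂ h₃
  have : Finite Wb := (Set.finite_range f).to_subtype
  have : Finite Wa := ((Set.finite_range a).sdiff).to_subtype
  obtain ⟨G, hG, hGf⟩ := Generic.exists_embedding_extending hd hc
    (f := fun p : ι × β => (Sum.inl ⟨f p, ⟨p, rfl⟩⟩ : Wb ⊕ Wa)) (g := f)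
    (pattern_eq_iff.2 ⟨fun x y => Sum.inl_injective.eq_iff.trans Subtype.ext_iff, fun _ _ _ => Iff.rfl, fun _ _ _ => Iff.rfl⟩)
  have hGl : ∀ i s, G (Sum.inl ⟨b' i s, ⟨(i, s), rfl⟩⟩) = b' i s := fun i s => congrFun hGf (i, s)
  refine ⟨fun t => if h : a t ∈ Set.range b then a t else G (Sum.inr ⟨a t, ⟨t, rfl⟩, h⟩),
    fun i => ?_⟩
  have hj : ∀ o : α ⊕ β, ∃ v : Wb ⊕ Wa,
      G v = Sum.elim (fun t => if h : a t ∈ Set.range b then a t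
        else G (Sum.inr ⟨a t, ⟨t, rfl⟩, h⟩)) (b' i) o ∧
      ((∃ s, v = Sum.inl ⟨b' i s, ⟨(i, s), rfl⟩⟩ ∧ Sum.elim a b o = b s) ∨
        ∃ x : Wa, v = Sum.inr x ∧ Sum.elim a b o = x) := by
    rintro (t | s)
    · by_cases h : a t ∈ Set.range b
      · obtain ⟨s, hs⟩ := h
        refine ⟨Sum.inl ⟨b' i s, ⟨(i, s), rfl⟩⟩, ?_, Or.inl ⟨s, rfl, hs.symm⟩⟩
        rw [hGl, ha t s hs.symm, Sum.elim_inl, dif_pos ⟨s, hs⟩, hs]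
      · exact ⟨Sum.inr ⟨a t, ⟨t, rfl⟩, h⟩, by rw [Sum.elim_inl, dif_neg h], Or.inr ⟨_, rfl, rfl⟩⟩
    · exact ⟨_, hGl i s, Or.inl ⟨s, rfl, rfl⟩⟩
  choose j hjG hj using hj
  have e₁ : Sum.elim (fun t => if h : a t ∈ Set.range b then a t
        else G (Sum.inr ⟨a t, ⟨t, rfl⟩, h⟩)) (b' i) = G ∘ j := funext fun o => (hjG o).symm
  rw [e₁, ← pattern_comp hG j]
  obtain ⟨q₁, q₂, q₃⟩ := pattern_eq_iff.1 (hb i)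
  refine pattern_eq_iff.2 ⟨fun o o' => ?_, fun o o' o'' => ?_, fun l o o' => ?_⟩
  · rcases hj o with ⟨s, h, h'⟩ | ⟨x, h, h'⟩ <;> rcases hj o' with ⟨t, g, g'⟩ | ⟨y, g, g'⟩ <;>
      simp only [Function.comp_apply, id, h, h', g, g']
    · exact (Sum.inl_injective.eq_iff.trans Subtype.ext_iff).trans (q₁ s t)
    · simpa using (hWa y s).symm
    · simpa using hWa x t
    · simp [Subtype.coe_inj]
  · rcases hj o with ⟨s, h, h'⟩ | ⟨x, h, h'⟩ <;> rcases hj o' with ⟨t, g, g'⟩ | ⟨y, g, g'⟩ <;>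
      rcases hj o'' with ⟨u, f, f'⟩ | ⟨z, f, f'⟩ <;>
      simp only [Function.comp_apply, id, h, h', g, g', f, f']
    · exact q₂ s t u
    · exact (mix_iff z i s t).trans hR₂
    · exact (mix_iff y i s u).trans hR₁
    · simp only [d, hks]
      exact hR₂.trans hR₂
    · exact mix_iff x i t u
    · simp only [d, hks]
      exact hR₃
    · simp only [d, hks]
    · rfl
  · rcases hj o with ⟨s, h, h'⟩ | ⟨x, h, h'⟩ <;> rcases hj o' with ⟨t, g, g'⟩ | ⟨y, g, g'⟩ <;>
      simp only [Function.comp_apply, id, h, h', g, g']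
    · exact q₃ l s t
    · simp only [d, hks]
      exact hc.good.E_symm
    · simp only [d, hks]
    · rfl

end ColoredHypergraph

/-- An infinite family of finite tuples contains arbitrarily large finite subfamilies any two of
whose members share entries only in equal positions. -/
theorem exists_spread_subfamily {M β : Type} [Finite β] (S : Set ℕ) (hS : S.Infinite)
    (f : ℕ → β → M) (k : ℕ) : ∃ T : Finset ℕ, T.card = k ∧ (T : Set ℕ) ⊆ S ∧
      ∀ i ∈ T, ∀ j ∈ T, ∀ s t, f i s = f j t → f i s = f i t := by
  classical
  -- A Δ-system argument: `D` is a maximal set of positions that are constant along some infinite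
  -- subfamily. By maximality every other position takes each value only finitely often on `S'`, so
  -- fresh values can be chosen greedily.
  obtain ⟨D, ⟨S', hS'S, hS', hD⟩, hmax⟩ := (Set.toFinite {D : Set β | ∃ S' ⊆ S, S'.Infinite ∧
    ∀ s ∈ D, ∀ i ∈ S', ∀ j ∈ S', f i s = f j s}).exists_maximal ⟨∅, S, subset_rfl, hS, by simp⟩
  have hfin : ∀ s ∉ D, ∀ d, {i ∈ S' | f i s = d}.Finite := by
    intro s hs d
    by_contra hinf
    refine hs (hmax (y := insert s D) ⟨{i ∈ S' | f i s = d}, fun i hi => hS'S hi.1, hinf, ?_⟩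
      (Set.subset_insert s D) (Set.mem_insert s D))
    rintro t (rfl | ht) i hi j hj
    · exact hi.2.trans hj.2.symm
    · exact hD t ht i hi.1 j hj.1
  -- The constant values at positions in `D` are entries of `f i₁`; `P` below keeps the other
  -- positions away from them.
  obtain ⟨i₁, hi₁⟩ := hS'.nonempty
  have avoid : ∀ F : Set M, F.Finite → ∀ X : Set ℕ, X.Finite →
      ∃ i ∈ S', i ∉ X ∧ ∀ s ∉ D, f i s ∉ F := by
    intro F hF X hX
    have hbad : (X ∪ ⋃ s ∈ Dᶜ, ⋃ d ∈ F, {i ∈ S' | f i s = d}).Finite :=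
      hX.union ((Set.toFinite Dᶜ).biUnion fun s hs => hF.biUnion fun d _ => hfin s hs d)
    obtain ⟨i, hi, hi'⟩ := (hS'.sdiff hbad).nonempty
    refine ⟨i, hi, fun h => hi' (Or.inl h), fun s hs h => hi' (Or.inr ?_)⟩
    simp only [Set.mem_iUnion]
    exact ⟨s, hs, f i s, h, hi, rfl⟩
  let P : ℕ → Prop := fun i => i ∈ S' ∧ ∀ s ∉ D, f i s ∉ Set.range (f i₁)
  let r : ℕ → ℕ → Prop := fun i j => i ≠ j ∧ ∀ s ∉ D, ∀ t ∉ D, f i s ≠ f j t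
  have : Std.Symm r := ⟨fun i j h => ⟨h.1.symm, fun s hs t ht => (h.2 t ht s hs).symm⟩⟩
  obtain ⟨g, hgP, hgr⟩ := exists_seq_of_forall_finset_exists' P r (by
    intro X _
    obtain ⟨i, hi, hiX, hiF⟩ := avoid (Set.range (f i₁) ∪ ⋃ j ∈ X, Set.range (f j))
      ((Set.finite_range _).union (X.finite_toSet.biUnion fun j _ => Set.finite_range _)) X
      X.finite_toSet
    refine ⟨i, ⟨hi, fun s hs h => hiF s hs (Or.inl h)⟩, fun j hj => ⟨?_, fun s hs t ht h => ?_⟩⟩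
    · rintro rfl
      exact hiX hj
    · refine hiF t ht (Or.inr ?_)
      simp only [Set.mem_iUnion]
      exact ⟨j, hj, s, h⟩)
  have hginj : Function.Injective g := fun i j hij => by
    by_contra h
    exact (hgr h).1 hij
  refine ⟨(Finset.range k).map ⟨g, hginj⟩, by simp, ?_, ?_⟩
  · intro i hi
    obtain ⟨n, -, rfl⟩ := Finset.mem_map.1 hi
    exact hS'S (hgP n).1
  · intro i hi j hj s t hst
    obtain ⟨n, -, rfl⟩ := Finset.mem_map.1 hi
    obtain ⟨m, -, rfl⟩ := Finset.mem_map.1 hj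
    change f (g n) s = f (g m) t at hst
    change f (g n) s = f (g n) t
    by_cases hnm : n = m
    · subst hnm
      exact hst
    by_cases hs : s ∈ D <;> by_cases ht : t ∈ D
    · exact hst.trans (hD t ht _ (hgP m).1 _ (hgP n).1)
    · exact ((hgP m).2 t ht ⟨s, (hD s hs _ hi₁ _ (hgP n).1).trans hst⟩).elim
    · exact ((hgP n).2 s hs ⟨t, (hD t ht _ hi₁ _ (hgP m).1).trans hst.symm⟩).elim
    · exact ((hgr hnm).2 s hs t ht hst).elim

/-! ### Branches of trees and the failure of the tree property -/

theorem initialSegment_succ {α : Type} (σ : ℕ → α) (n : ℕ) :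
    initialSegment σ (n + 1) = initialSegment σ n ++ [σ n] := by
  simp [initialSegment, List.range_succ]

theorem take_initialSegment {α : Type} (σ : ℕ → α) {l n : ℕ} (h : l ≤ n) :
    (initialSegment σ n).take l = initialSegment σ l := by
  simp [initialSegment, ← List.map_take, List.take_range, h]

theorem exists_initialSegment_eq {α : Type} (next : List α → α) :
    ∃ σ : ℕ → α, ∀ n, σ n = next (initialSegment σ n) := by
  let ν : ℕ → List α := fun n => Nat.rec [] (fun _ l => l ++ [next l]) n
  have h : ∀ n, initialSegment (fun n => next (ν n)) n = ν n := by
    intro n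
    induction n with
    | zero => rfl
    | succ n ih => rw [initialSegment_succ, ih]
  exact ⟨fun n => next (ν n), fun n => by rw [h]⟩

namespace ColoredLanguage

open ColoredHypergraph

variable {L : FirstOrder.Language.{0, 0}} {I : Type} [ColoredLanguage L I] {sgn : I → Prop}

/-- Follow a branch on which each next node has infinitely many siblings of the same type over the
path. Let `a` satisfy the formulas along it. At some level the new parameter shares with `a` only
entries already on the path; there `Generic.exists_simultaneous` realizes the formula at `k`
siblings at once, against `k`-inconsistency. -/
theorem isSimple_genericTheory [Finite I] [Subsingleton I] : IsSimple (genericTheory L sgn) := by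
  rintro m n φ k - ⟨M, b, hinc, hcon⟩
  have hM := model_genericTheory_iff.1 M.is_model
  -- The whole path up to and including `η` is put into the tuple, so siblings of equal pattern
  -- agree on every entry that occurs there.
  let pre : ∀ η : List ℕ, Fin (η.length + 1) × Fin n → M := fun η p => b (η.take p.1) p.2
  let tup : ∀ η : List ℕ, ℕ → (Fin (η.length + 1) × Fin n) ⊕ Fin n → M :=
    fun η i => Sum.elim (pre η) (b (η ++ [i]))
  have hnext : ∀ η : List ℕ, ∃ i, {j | (toColored L M).pattern (tup η j) =
      (toColored L M).pattern (tup η i)}.Infinite := by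
    intro η
    obtain ⟨τ, hτ⟩ := Finite.exists_infinite_fiber fun j => (toColored L M).pattern (tup η j)
    have hτ' := Set.infinite_coe_iff.1 hτ
    obtain ⟨i, hi⟩ := hτ'.nonempty
    refine ⟨i, hτ'.mono fun j hj => ?_⟩
    exact (Set.mem_singleton_iff.1 hj).trans (Set.mem_singleton_iff.1 hi).symm
  choose next hnext using hnext
  obtain ⟨σ, hσ⟩ := exists_initialSegment_eq next
  obtain ⟨a, ha⟩ := hcon σ (m + 1)
  -- Pigeonhole: otherwise each of `m + 1` levels would be the first occurrence of some entry of
  -- `a`, and these entries have distinct indices, of which there are only `m`.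
  obtain ⟨j, hjm, hj⟩ : ∃ j ≤ m, ∀ t s, a t = b (initialSegment σ (j + 1)) s →
      ∃ l ≤ j, ∃ s', a t = b (initialSegment σ l) s' := by
    by_contra! H
    have H' : ∀ j : Fin (m + 1), ∃ t, (∃ s, a t = b (initialSegment σ (j + 1)) s) ∧
        ∀ l ≤ (j : ℕ), ∀ s', a t ≠ b (initialSegment σ l) s' := fun j => by
      obtain ⟨t, s, h, h'⟩ := H j (by omega)
      exact ⟨t, ⟨s, h⟩, h'⟩
    choose t ht ht' using H'
    have hlt : ∀ i j : Fin (m + 1), i < j → t i ≠ t j := by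
      intro i j hij h
      obtain ⟨s, hs⟩ := ht i
      exact ht' j (i + 1) hij s (h ▸ hs)
    have hinj : Function.Injective t := fun i j h => by
      rcases lt_trichotomy i j with hij | hij | hij
      · exact (hlt i j hij h).elim
      · exact hij
      · exact (hlt j i hij h.symm).elim
    simpa using Fintype.card_le_of_injective t hinj
  obtain ⟨η, hη⟩ : ∃ η, η = initialSegment σ j := ⟨_, rfl⟩
  have hlen : η.length = j := by simp [hη, initialSegment]
  have hseg : initialSegment σ (j + 1) = η ++ [next η] := by rw [initialSegment_succ, hσ j, hη]
  have hφ := ha (j + 1) (by omega)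
  rw [hseg] at hφ hj
  have hpre : ∀ t s, a t = b (η ++ [next η]) s → ∃ p, a t = pre η p := by
    intro t s h
    obtain ⟨l, hl, s', hs'⟩ := hj t s h
    refine ⟨(⟨l, by omega⟩, s'), ?_⟩
    simp only [pre]
    rw [hη, take_initialSegment σ hl]
    exact hs'
  obtain ⟨T, hTk, hTS, hT⟩ := exists_spread_subfamily _ (hnext η) (tup η) k
  have hpat : ∀ i : T, (toColored L M).pattern (tup η i) =
      (toColored L M).pattern (tup η (next η)) := fun i => hTS i.2
  obtain ⟨a', ha'⟩ := hM.exists_simultaneous a (tup η (next η)) (fun i : T => tup η i) hpat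
    (fun i i' s s' h => ((pattern_eq_iff.1 (hpat i)).1 s s').1 (hT i i.2 i' i'.2 s s' h)) (by
      rintro t (p | s) h i
      · rfl
      · obtain ⟨p, hp⟩ := hpre t s h
        have h₁ : tup η (next η) (Sum.inr s) = tup η (next η) (Sum.inl p) := h.symm.trans hp
        have h₂ := ((pattern_eq_iff.1 (hpat i)).1 (Sum.inr s) (Sum.inl p)).2 h₁
        exact h₂.trans h₁.symm)
  refine hinc η T hTk ⟨a', fun i hi => ?_⟩
  have h := pattern_comp (ha' ⟨i, hi⟩) (Sum.map id Sum.inr : Fin m ⊕ Fin n → _)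
  have key : ∀ (x : Fin m → M) (i : ℕ), Sum.elim x (tup η i) ∘ (Sum.map id Sum.inr) =
      Sum.elim x (b (η ++ [i])) := by
    intro x i
    funext o
    rcases o with o | o <;> rfl
  rw [key, key] at h
  exact (realize_iff_of_pattern_eq hM hM φ h).2 hφ

end ColoredLanguage

/-- Code a natural number `i` by the word $0^i1$. For `i < j` the code of `η⌢j` extends `e η`
followed by $0^i0$, while that of `η⌢i` is `e η` followed by $0^i1$, so siblings are 2-inconsistent.
-/
theorem HasSOP1.hasTreeProperty {L : FirstOrder.Language.{0, 0}} {T : L.Theory} {m n : ℕ}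
    {φ : L.Formula (Fin m ⊕ Fin n)} (h : HasSOP1 T φ) : HasTreeProperty T φ 2 := by
  obtain ⟨M, b, hinc, hcon⟩ := h
  let e : List ℕ → List Bool := fun η => η.flatMap fun i => List.replicate i false ++ [true]
  have he : ∀ η i, e (η ++ [i]) = e η ++ List.replicate i false ++ [true] := by
    intro η i
    simp [e]
  have key : ∀ η i j, i < j → ¬ ∃ a : Fin m → M, φ.Realize (Sum.elim a (b (e (η ++ [j])))) ∧
      φ.Realize (Sum.elim a (b (e (η ++ [i])))) := by
    intro η i j hij
    rw [he η i]
    refine hinc _ _ ?_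
    rw [he, show j = i + (1 + (j - i - 1)) by omega, List.replicate_add, List.replicate_add]
    simp
  refine ⟨M, fun η => b (e η), ?_, ?_⟩
  · rintro η s hs ⟨a, ha⟩
    obtain ⟨i, j, hij, rfl⟩ := Finset.card_eq_two.1 hs
    have hi := ha i (by simp)
    have hj := ha j (by simp)
    rcases lt_or_gt_of_ne hij with h | h
    · exact key η i j h ⟨a, hj, hi⟩
    · exact key η j i h ⟨a, hi, hj⟩
  · intro σ N
    let l := e (initialSegment σ N)
    -- The finite word `l` is padded with `false` to a branch; only its initial segments of length
    -- at most `l.length` matter.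
    obtain ⟨a, ha⟩ := hcon (fun p => l.getD p false) l.length
    refine ⟨a, fun j hj => ?_⟩
    have hpre : e (initialSegment σ j) <+: l := by
      rw [← take_initialSegment σ hj]
      exact ⟨e ((initialSegment σ N).drop j), by
        simp only [e, l]
        rw [← List.flatMap_append, List.take_append_drop]⟩
    have hseg : initialSegment (fun p => l.getD p false) (e (initialSegment σ j)).length =
        e (initialSegment σ j) := by
      refine List.ext_getElem (by simp [initialSegment]) fun p h₁ h₂ => ?_
      have hp : p < l.length := h₂.trans_le hpre.length_le
      simp only [initialSegment, List.getElem_map, List.getElem_range]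
      rw [List.getD_eq_getElem _ _ hp]
      exact (hpre.getElem h₂).symm
    have := ha _ hpre.length_le
    rwa [hseg] at this

theorem IsSimple.isNSOP1 {L : FirstOrder.Language.{0, 0}} {T : L.Theory} (h : IsSimple T) :
    IsNSOP1 T :=
  fun m n φ hφ => h m n φ 2 le_rfl (HasSOP1.hasTreeProperty hφ)

/-! ## The interpolative fusion -/

namespace ColoredHypergraph

variable {I M α β : Type} {sgn : I → Prop}

/-- Tuples realizing the same hypergraph type over `b` can be replaced by a single tuple, which has
the type of `f i` over `b` in each colour `i`. -/
theorem Generic.exists_common [Finite α] [Finite β] {c : ColoredHypergraph I M}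
    (hc : c.Generic sgn) (b : α → M) (f : I → β → M) (f₀ : β → M)
    (h : ∀ i, (c.reduct Empty.elim).pattern (Sum.elim b (f i)) =
      (c.reduct Empty.elim).pattern (Sum.elim b f₀)) :
    ∃ u : β → M, ∀ i, (c.reduct fun _ : Unit => i).pattern (Sum.elim b u) =
      (c.reduct fun _ : Unit => i).pattern (Sum.elim b (f i)) := by
  let F : I → α ⊕ β → M := fun i => Sum.elim b (f i)
  let F₀ : α ⊕ β → M := Sum.elim b f₀
  let V := Set.range F₀
  have hF₁ : ∀ i s t, F i s = F i t ↔ F₀ s = F₀ t := fun i => (pattern_eq_iff.1 (h i)).1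
  have hF₂ : ∀ i s t u, c.R (F i s) (F i t) (F i u) ↔ c.R (F₀ s) (F₀ t) (F₀ u) :=
    fun i => (pattern_eq_iff.1 (h i)).2.1
  let e : α ⊕ β → V := Set.rangeFactorization F₀
  have he : Function.Surjective e := Set.rangeFactorization_surjective
  let k : I → V → M := fun i v => F i v.2.choose
  have hk : ∀ i s, k i (e s) = F i s := fun i s => (hF₁ i _ _).2 (e s).2.choose_spec
  -- Hyperedges come from `f₀`, edges of colour `i` from `f i`. Goodness survives because each
  -- triangle rule compares one colour with the hyperedges, on which all the tuples agree.
  let d : ColoredHypergraph I V := ⟨fun x y z => c.R x y z, fun i x y => c.E i (k i x) (k i y)⟩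
  have hd : d.Good sgn := by
    refine ⟨(hc.good.comap Subtype.val_injective).hyper,
      fun i => ⟨fun x y => (hc.good.graph i).1 _ _, fun x => (hc.good.graph i).2 _⟩,
      fun i x y z h₁ h₂ h₃ => ?_⟩
    obtain ⟨s, rfl⟩ := he x
    obtain ⟨t, rfl⟩ := he y
    obtain ⟨u, rfl⟩ := he z
    refine (hF₂ i s t u).symm.trans ?_
    simp only [d, hk] at h₁ h₂ h₃
    exact hc.good.triangle i _ _ _ h₁ h₂ h₃
  have : Finite V := (Set.finite_range F₀).to_subtype
  have hpat : d.pattern (fun a => e (Sum.inl a)) = c.pattern b := by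
    refine pattern_eq_iff.2 ⟨fun x y => Subtype.ext_iff, fun x y z => Iff.rfl, fun i x y => ?_⟩
    simp only [d, hk]
    rfl
  obtain ⟨G, hG, hGb⟩ := Generic.exists_embedding_extending hd hc hpat
  refine ⟨fun s => G (e (Sum.inr s)), fun i => ?_⟩
  have key : Sum.elim b (fun s => G (e (Sum.inr s))) = G ∘ e := by
    funext o
    rcases o with a | s
    · exact (congrFun hGb a).symm
    · rfl
  rw [key, ← pattern_reduct (pattern_comp hG e) fun _ : Unit => i]
  refine pattern_eq_iff.2 ⟨fun x y => Subtype.ext_iff.trans (hF₁ i x y).symm,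
    fun x y z => (hF₂ i x y z).symm, fun _ x y => ?_⟩
  change c.E i (k i (e x)) (k i (e y)) ↔ c.E i (F i x) (F i y)
  rw [hk, hk]

theorem ext_of_empty {V : Type} {c d : ColoredHypergraph Empty V} (h : c.R = d.R) : c = d := by
  cases c
  cases d
  obtain rfl := h
  congr
  funext i
  exact i.elim

end ColoredHypergraph

namespace ColoredLanguage

open ColoredHypergraph AtomicTypes

section

variable {L : FirstOrder.Language.{0, 0}} {I : Type} [ColoredLanguage L I] {sgn : I → Prop}
  {M : Type} [L.Structure M] {n : ℕ}

/-- A definable set in a generic structure is determined by the types over finitely many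
parameters. -/
theorem exists_finset_of_definable (hM : (toColored L M).Generic sgn) {S : Set (Fin n → M)}
    (hS : (Set.univ : Set M).Definable L S) : ∃ B : Finset M, ∀ B' : Set M, ↑B ⊆ B' → ∀ v w,
      (toColored L M).pattern (Sum.elim (fun b : B' => (b : M)) v) =
        (toColored L M).pattern (Sum.elim (fun b : B' => (b : M)) w) → (v ∈ S ↔ w ∈ S) := by
  obtain ⟨B, -, hS⟩ := Set.definable_iff_finitely_definable.1 hS
  obtain ⟨φ, rfl⟩ := Set.definable_iff_exists_formula_sum.1 hS
  refine ⟨B, fun B' hB v w h => realize_iff_of_pattern_eq hM hM φ ?_⟩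
  have := pattern_comp h (Sum.map (fun b : B => ⟨b, hB b.2⟩) id)
  have key : ∀ v : Fin n → M, Sum.elim (fun b : B' => (b : M)) v ∘
      (Sum.map (fun b : B => ⟨b, hB b.2⟩) id) = Sum.elim (fun b : B => (b : M)) v := by
    intro v
    funext o
    rcases o with o | o <;> rfl
  rwa [key, key] at this

/-- A union of types over a finite set of parameters is definable. -/
theorem definable_of_pattern [Finite I] {B : Set M} (hB : B.Finite) {S : Set (Fin n → M)}
    (hS : ∀ v w, (toColored L M).pattern (Sum.elim (fun b : B => (b : M)) v) =
      (toColored L M).pattern (Sum.elim (fun b : B => (b : M)) w) → v ∈ S → w ∈ S) :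
    (Set.univ : Set M).Definable L S := by
  have := hB.to_subtype
  refine Set.Definable.mono (A := B) (Set.definable_iff_exists_formula_sum.2
    ⟨Formula.iSup fun τ : {τ // ∃ v ∈ S, atomicType L (Sum.elim (fun b : B => (b : M)) v) = τ} =>
      atomicTypeFormula τ.1, ?_⟩) (Set.subset_univ B)
  ext w
  simp only [Set.mem_ofPred_eq, Formula.realize_iSup, realize_atomicTypeFormula]
  constructor
  · exact fun hw => ⟨⟨_, w, hw, rfl⟩, rfl⟩
  · rintro ⟨⟨_, v, hv, rfl⟩, h⟩
    exact hS v w (atomicType_eq_iff_pattern_eq.1 h.symm) hv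

end

/-- The triangle conditions of the two edge relations of the fusion. -/
def fusionSign : Fin 2 → Prop := ![True, False]

section

variable {M : Type} [(unionLanguage hypergraphLanguage extraSymbols).Structure M]

theorem toColored_reduct_base :
    letI := (baseIncl hypergraphLanguage extraSymbols).reduct M
    toColored hypergraphLanguage M =
      (toColored (unionLanguage hypergraphLanguage extraSymbols) M).reduct Empty.elim :=
  ext_of_empty rfl

/-- Let `C` contain parameters for both sets. A hypergraph type over `C` met by both would, by
`Generic.exists_common`, produce a point in the intersection. So the union `Y` of the hypergraph
types meeting `S 0` separates the two sets. -/
theorem isInterpolative_of_generic [Nonempty M]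
    (hM : (toColored (unionLanguage hypergraphLanguage extraSymbols) M).Generic fusionSign) :
    IsInterpolative hypergraphLanguage extraSymbols M := by
  classical
  intro n J S hS hJ
  -- If `J` is a singleton, its set is already empty; `J = ∅` is impossible since `M` is nonempty.
  by_cases hJ' : ∀ i, i ∈ J
  swap
  · refine ⟨fun _ => ∅, fun i hi => ⟨by
      let := (baseIncl hypergraphLanguage extraSymbols).reduct M
      exact Set.definable_empty, ?_⟩, ?_⟩
    · obtain ⟨j, hj⟩ := not_forall.1 hJ'
      have : S i = ⋂ i ∈ J, S i := by
        have hJi : ∀ k ∈ J, k = i := by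
          intro k hk
          have h₁ : k ≠ j := fun h => hj (h ▸ hk)
          have h₂ : i ≠ j := fun h => hj (h ▸ hi)
          omega
        ext v
        simp only [Set.mem_iInter]
        exact ⟨fun hv k hk => hJi k hk ▸ hv, fun h => h i hi⟩
      rw [this, hJ]
    · have : J.Nonempty := by
        rw [Finset.nonempty_iff_ne_empty]
        rintro rfl
        simp at hJ
      obtain ⟨i, hi⟩ := this
      exact Set.eq_empty_of_subset_empty (Set.biInter_subset_of_mem hi)
  set c := toColored (unionLanguage hypergraphLanguage extraSymbols) M with hc
  have h : ∀ i, ∃ B : Finset M, ∀ B' : Set M, ↑B ⊆ B' → ∀ v w,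
      (c.reduct fun _ : Unit => i).pattern (Sum.elim (fun b : B' => (b : M)) v) =
        (c.reduct fun _ : Unit => i).pattern (Sum.elim (fun b : B' => (b : M)) w) →
          (v ∈ S i ↔ w ∈ S i) := by
    intro i
    let := (incl hypergraphLanguage extraSymbols i).reduct M
    exact exists_finset_of_definable (L := expandedLanguage) (M := M)
      (hM.reduct (Function.injective_of_subsingleton fun _ : Unit => i)) (hS i (hJ' i))
  choose B hB using h
  let C : Set M := ⋃ i, (B i : Set M)
  have hC : C.Finite := Set.finite_iUnion fun i => (B i).finite_toSet
  have := hC.to_subtype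
  let Y : Set (Fin n → M) := {v | ∃ w ∈ S 0,
    (c.reduct Empty.elim).pattern (Sum.elim (fun b : C => (b : M)) v) =
      (c.reduct Empty.elim).pattern (Sum.elim (fun b : C => (b : M)) w)}
  have hY : ReductDefinable (baseIncl hypergraphLanguage extraSymbols) Y := by
    let := (baseIncl hypergraphLanguage extraSymbols).reduct M
    refine definable_of_pattern (L := hypergraphLanguage) hC ?_
    rw [toColored_reduct_base]
    rintro v v' hv ⟨w, hw, h⟩
    exact ⟨w, hw, Eq.trans hv.symm h⟩
  have hYc : ReductDefinable (baseIncl hypergraphLanguage extraSymbols) Yᶜ := by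
    let := (baseIncl hypergraphLanguage extraSymbols).reduct M
    exact Set.Definable.compl hY
  refine ⟨![Y, Yᶜ], fun i _ => ?_, ?_⟩
  · fin_cases i
    · exact ⟨hY, fun v hv => ⟨v, hv, rfl⟩⟩
    · refine ⟨hYc, fun v hv => ?_⟩
      rintro ⟨w, hw, h⟩
      obtain ⟨u, hu⟩ := hM.exists_common (fun b : C => (b : M)) ![w, v] w (by
        intro i
        fin_cases i
        · rfl
        · exact h)
      have huS : u ∈ ⋂ i ∈ J, S i := by
        simp only [Set.mem_iInter]
        intro i _
        refine (hB i C (Set.subset_iUnion (fun i => (B i : Set M)) i) _ _ (hu i)).2 ?_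
        fin_cases i
        · exact hw
        · exact hv
      rw [hJ] at huS
      exact huS
  · refine Set.eq_empty_of_forall_notMem fun v hv => ?_
    simp only [Set.mem_iInter] at hv
    exact hv 1 (hJ' 1) (hv 0 (hJ' 0))

/-- If the two halves `S 0`, `S 1` of an extension type had no common point, interpolants would
separate them. But over parameters of an interpolant the two halves have realizations of the same
hypergraph type, which no $L_\cap$-definable set can distinguish. -/
theorem generic_of_isInterpolative
    (hM : ∀ i : Fin 2, ((toColored (unionLanguage hypergraphLanguage extraSymbols) M).reduct
      fun _ : Unit => i).Generic fun _ => fusionSign i)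
    (h : IsInterpolative hypergraphLanguage extraSymbols M) :
    (toColored (unionLanguage hypergraphLanguage extraSymbols) M).Generic fusionSign := by
  classical
  set c := toColored (unionLanguage hypergraphLanguage extraSymbols) M with hc
  refine ⟨⟨(hM 0).good.hyper, fun i => (hM i).good.graph (), fun i => (hM i).good.triangle ()⟩,
    fun A hA e r hr => ?_⟩
  let S : Fin 2 → Set (Fin 1 → M) := fun i => {v | v 0 ∉ A ∧
    (∀ a ∈ A, c.E i (v 0) a ↔ e i a) ∧ ∀ a ∈ A, ∀ b ∈ A, c.R (v 0) a b ↔ r a b}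
  suffices hne : (⋂ i ∈ (Finset.univ : Finset (Fin 2)), S i).Nonempty by
    obtain ⟨v, hv⟩ := hne
    simp only [Set.mem_iInter] at hv
    have hv' := fun i => hv i (Finset.mem_univ i)
    exact ⟨v 0, (hv' 0).1, fun i => (hv' i).2.1, (hv' 0).2.2⟩
  by_contra hne
  rw [Set.not_nonempty_iff_eq_empty] at hne
  obtain ⟨Y, hY, hYe⟩ := h 1 Finset.univ S (fun i _ => by
    let := (incl hypergraphLanguage extraSymbols i).reduct M
    refine definable_of_pattern (L := expandedLanguage) hA ?_
    rintro v w h ⟨hv₁, hv₂, hv₃⟩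
    obtain ⟨p₁, p₂, p₃⟩ := pattern_eq_iff.1 h
    refine ⟨fun hw => hv₁ ?_, fun a ha => ?_, fun a ha b hb => ?_⟩
    · rw [show v 0 = w 0 from (p₁ (Sum.inr 0) (Sum.inl ⟨w 0, hw⟩)).2 rfl]
      exact hw
    · exact (p₃ () (Sum.inr 0) (Sum.inl ⟨a, ha⟩)).symm.trans (hv₂ a ha)
    · exact (p₂ (Sum.inr 0) (Sum.inl ⟨a, ha⟩) (Sum.inl ⟨b, hb⟩)).symm.trans (hv₃ a ha b hb)) hne
  have hbase : (c.reduct Empty.elim).Generic fun i : Empty => i.elim := by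
    have := (hM 0).reduct (e := (Empty.elim : Empty → Unit)) (fun i => i.elim)
    have he : (c.reduct fun _ : Unit => 0).reduct Empty.elim = c.reduct Empty.elim :=
      ext_of_empty rfl
    rwa [Subsingleton.elim ((fun _ => fusionSign _) ∘ Empty.elim) fun i : Empty => i.elim,
      he] at this
  have hYB : ∃ B : Finset M, ∀ B' : Set M, ↑B ⊆ B' → ∀ v w,
      (c.reduct Empty.elim).pattern (Sum.elim (fun b : B' => (b : M)) v) =
        (c.reduct Empty.elim).pattern (Sum.elim (fun b : B' => (b : M)) w) →
          (v ∈ Y 1 ↔ w ∈ Y 1) := by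
    let := (baseIncl hypergraphLanguage extraSymbols).reduct M
    rw [← toColored_reduct_base] at hbase ⊢
    exact exists_finset_of_definable (L := hypergraphLanguage) hbase (hY 1 (Finset.mem_univ 1)).1
  obtain ⟨B, hB⟩ := hYB
  let C : Set M := A ∪ B
  have hC : C.Finite := hA.union B.finite_toSet
  -- Each half is realized with no edge of its colour to, and no hyperedge involving, the extra
  -- parameters outside `A`. This prescribes the same hyperedges over `C` for both colours.
  have hx : ∀ i, ∃ x, x ∉ C ∧ (fun _ => x) ∈ S i ∧ ∀ a ∈ C, ∀ b ∈ C,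
      (c.R x a b ↔ a ∈ A ∧ b ∈ A ∧ r a b) := by
    intro i
    obtain ⟨x, hxC, hE, hR⟩ := (hM i).extend C hC (fun _ a => a ∈ A ∧ e i a)
      (fun a b => a ∈ A ∧ b ∈ A ∧ r a b) ⟨by
        rintro a - b - ⟨ha, hb, H⟩
        exact ⟨⟨hb, ha, (hr.symm a ha b hb H).1⟩, (hr.symm a ha b hb H).2⟩, by
        rintro _ a - b - ⟨ha, h₁⟩ ⟨hb, h₂⟩ h₃
        simpa [ha, hb] using hr.triangle i a ha b hb h₁ h₂ h₃⟩
    refine ⟨x, hxC, ⟨fun hxA => hxC (Or.inl hxA), fun a ha => ?_, fun a ha b hb => ?_⟩, hR⟩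
    · exact (hE () a (Or.inl ha)).trans (and_iff_right ha)
    · exact (hR a (Or.inl ha) b (Or.inl hb)).trans (by simp [ha, hb])
  choose x hxC hxS hxR using hx
  have hpat : (c.reduct Empty.elim).pattern (Sum.elim (fun b : C => (b : M)) fun _ : Fin 1 => x 0) =
      (c.reduct Empty.elim).pattern (Sum.elim (fun b : C => (b : M)) fun _ : Fin 1 => x 1) := by
    have hr : ∀ i, x i ∉ Set.range fun b : C => (b : M) := by
      rintro i ⟨b, hb⟩
      exact hxC i (hb ▸ b.2)
    have := pattern_comp (pattern_option hbase.good hbase.good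
      (rfl : (c.reduct Empty.elim).pattern (fun b : C => (b : M)) = _) (hr 0) (hr 1)
      (fun i => i.elim) fun s t => (hxR 0 s s.2 t t.2).trans (hxR 1 s s.2 t t.2).symm)
      (Sum.elim some fun _ : Fin 1 => none)
    have key : ∀ z : M, (fun o : Option C => o.elim z fun b : C => (b : M)) ∘
        (Sum.elim some fun _ : Fin 1 => none) =
          Sum.elim (fun b : C => (b : M)) (fun _ => z) := by
      intro z
      funext o
      rcases o with a | a <;> rfl
    rwa [key, key] at this
  have hmem : (fun _ => x 0) ∈ ⋂ i ∈ (Finset.univ : Finset (Fin 2)), Y i := by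
    simp only [Set.mem_iInter]
    intro i _
    fin_cases i
    · exact (hY 0 (Finset.mem_univ 0)).2 (hxS 0)
    · exact (hB C Set.subset_union_right _ _ hpat).2 ((hY 1 (Finset.mem_univ 1)).2 (hxS 1))
  rw [hYe] at hmem
  exact hmem

end

/-! ### Axiomatization and completeness of the fusion -/

/-- The theories of the Fraïssé limits of the two classes of expanded hypergraphs. -/
noncomputable def componentTheory (i : Fin 2) : expandedLanguage.Theory :=
  genericTheory expandedLanguage fun _ => fusionSign i

theorem pair_componentTheory (i : Fin 2) :
    pair (componentTheory 0) (componentTheory 1) i = componentTheory i := by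
  fin_cases i <;> rfl

theorem model_unionTheory_iff {M : Type}
    [(unionLanguage hypergraphLanguage extraSymbols).Structure M] :
    M ⊨ unionTheory (pair (componentTheory 0) (componentTheory 1)) ↔
      ∀ i : Fin 2, ((toColored (unionLanguage hypergraphLanguage extraSymbols) M).reduct
        fun _ : Unit => i).Generic fun _ => fusionSign i := by
  have h₁ : M ⊨ unionTheory (pair (componentTheory 0) (componentTheory 1)) ↔
      ∀ i, M ⊨ (incl hypergraphLanguage extraSymbols i).onTheory
        (pair (componentTheory 0) (componentTheory 1) i) := by
    simp only [Theory.model_iff, unionTheory, Set.mem_iUnion]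
    exact ⟨fun h i φ hφ => h φ ⟨i, hφ⟩, fun h φ ⟨i, hφ⟩ => h i φ hφ⟩
  rw [h₁]
  refine forall_congr' fun i => ?_
  let := (incl hypergraphLanguage extraSymbols i).reduct M
  rw [LHom.onTheory_model, pair_componentTheory]
  exact model_genericTheory_iff (L := expandedLanguage)

theorem model_fusion_iff {M : Type} [Nonempty M]
    [(unionLanguage hypergraphLanguage extraSymbols).Structure M] :
    M ⊨ genericTheory (unionLanguage hypergraphLanguage extraSymbols) fusionSign ↔
      M ⊨ unionTheory (pair (componentTheory 0) (componentTheory 1)) ∧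
        IsInterpolative hypergraphLanguage extraSymbols M := by
  rw [model_genericTheory_iff, model_unionTheory_iff]
  refine ⟨fun h => ⟨fun i => ?_, isInterpolative_of_generic h⟩, fun h =>
    generic_of_isInterpolative h.1 h.2⟩
  exact h.reduct (Function.injective_of_subsingleton fun _ : Unit => i)

theorem fusion_eq :
    fusion (pair (componentTheory 0) (componentTheory 1)) =
      genericTheory (unionLanguage hypergraphLanguage extraSymbols) fusionSign := by
  ext φ
  constructor
  · intro h
    obtain ⟨_, hg⟩ := exists_countable_generic
      (unionLanguage hypergraphLanguage extraSymbols) fusionSign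
    have hm := model_fusion_iff.1 (model_genericTheory_iff.2 hg)
    rw [genericTheory_eq_completeTheory hg]
    exact h ℕ hm.1 hm.2
  · intro h M _ _ h₁ h₂
    exact (model_fusion_iff.2 ⟨h₁, h₂⟩).realize_of_mem φ h

theorem isComplete_genericTheory {L : FirstOrder.Language.{0, 0}} {I : Type}
    [ColoredLanguage L I] [Finite I] (sgn : I → Prop) : (genericTheory L sgn).IsComplete := by
  obtain ⟨_, hg⟩ := exists_countable_generic L sgn
  rw [genericTheory_eq_completeTheory hg]
  exact completeTheory.isComplete L ℕ

/-- The component theory is complete, so its consequences are read off in one countable model, whose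
hypergraph reduct is again generic. -/
theorem isBaseConsequences (i : Fin 2) :
    IsBaseConsequences (genericTheory hypergraphLanguage fun i => i.elim)
      (pair (componentTheory 0) (componentTheory 1) i) := by
  intro φ
  rw [pair_componentTheory]
  obtain ⟨_, hg⟩ := exists_countable_generic expandedLanguage fun _ => fusionSign i
  let := (LHom.sumInl : hypergraphLanguage →ᴸ expandedLanguage).reduct ℕ
  have hbase : (toColored hypergraphLanguage ℕ).Generic fun i : Empty => i.elim := by
    have := hg.reduct (e := (Empty.elim : Empty → Unit)) (fun i => i.elim)
    have he : toColored hypergraphLanguage ℕ = (toColored expandedLanguage ℕ).reduct Empty.elim :=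
      ext_of_empty rfl
    rwa [Subsingleton.elim ((fun _ => fusionSign i) ∘ Empty.elim) fun i : Empty => i.elim,
      ← he] at this
  rw [genericTheory_eq_completeTheory hbase, componentTheory]
  change _ ↔ genericTheory expandedLanguage (fun _ => fusionSign i) ⊨ᵇ _
  have := model_genericTheory_iff.2 hg
  rw [← (isComplete_genericTheory _).realize_sentence_iff _ ℕ, mem_completeTheory,
    LHom.realize_onSentence]

end ColoredLanguage

/-! ## The Henson graph in the fusion -/

namespace HensonGraph

open Structure AtomicTypes ColoredHypergraph ColoredLanguage

/-- The graph structure whose edges are the pairs joined by edges of both colours. -/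
@[reducible]
def commonEdgeStructure {M : Type} (c : ColoredHypergraph (Fin 2) M) :
    Language.graph.Structure M where
  funMap f := isEmptyElim f
  RelMap | .adj => fun v => c.E 0 (v 0) (v 1) ∧ c.E 1 (v 0) (v 1)

/-- The structure is a triangle-free graph. -/
def IsTriangleFree (V : Type) [Language.graph.Structure V] : Prop :=
  IsGraphRelation (fun a b : V => RelMap Language.adj ![a, b]) ∧
    ∀ x y z : V, ¬ (RelMap Language.adj ![x, y] ∧ RelMap Language.adj ![y, z] ∧
      RelMap Language.adj ![z, x])

instance : IsEmpty (Language.graph.Relations 0) := ⟨fun r => nomatch r⟩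

section

variable {M N V : Type} [Language.graph.Structure V]

theorem atomicType_graph_eq_iff [Language.graph.Structure M] {α : Type} {f : α → V} {g : α → M} :
    atomicType Language.graph f = atomicType Language.graph g ↔ (∀ x y, f x = f y ↔ g x = g y) ∧
      ∀ x y, (RelMap Language.adj ![f x, f y] ↔ RelMap Language.adj ![g x, g y]) := by
  have key : ∀ {U : Type} (h : α → U) (v : Fin 2 → α), h ∘ v = ![h (v 0), h (v 1)] := by
    intro U h v
    funext i
    fin_cases i <;> rfl
  rw [atomicType_eq_iff]
  refine and_congr Iff.rfl ⟨fun h x y => ?_, ?_⟩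
  · have := h 2 Language.adj ![x, y]
    rwa [key, key] at this
  · rintro h k ⟨⟩ v
    rw [key, key]
    exact h _ _

theorem IsTriangleFree.of_embedding [Language.graph.Structure M] (h : IsTriangleFree M)
    (f : V ↪[Language.graph] M) : IsTriangleFree V := by
  have key : ∀ x y, RelMap Language.adj ![x, y] ↔ RelMap Language.adj ![f x, f y] := fun x y =>
    (atomicType_graph_eq_iff.1 (atomicType_embedding_comp f (id : V → V)).symm).2 x y
  refine ⟨⟨fun a b hab => ?_, fun a ha => ?_⟩, fun x y z H => ?_⟩
  · exact (key _ _).2 (h.1.1 _ _ ((key _ _).1 hab))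
  · exact h.1.2 _ ((key _ _).1 ha)
  · rw [key, key, key] at H
    exact h.2 _ _ _ H

theorem not_common_triangle {c : ColoredHypergraph (Fin 2) M} (hc : c.Good fusionSign) {x y z : M}
    (h₁ : c.E 0 x y ∧ c.E 1 x y) (h₂ : c.E 0 y z ∧ c.E 1 y z) (h₃ : c.E 0 z x ∧ c.E 1 z x) :
    False :=
  (hc.triangle 1 x y z h₁.2 h₂.2 h₃.2).1 ((hc.triangle 0 x y z h₁.1 h₂.1 h₃.1).2 trivial)

theorem isTriangleFree_commonEdgeStructure {c : ColoredHypergraph (Fin 2) M}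
    (hc : c.Good fusionSign) :
    letI := commonEdgeStructure c
    IsTriangleFree M :=
  ⟨⟨fun _ _ h => ⟨(hc.graph 0).1 _ _ h.1, (hc.graph 1).1 _ _ h.2⟩,
    fun _ h => (hc.graph 0).2 _ h.1⟩, fun _ _ _ h => not_common_triangle hc h.1 h.2.1 h.2.2⟩

theorem backAndForth_commonEdgeStructure (hV : IsTriangleFree V)
    {c : ColoredHypergraph (Fin 2) M} (hc : c.Generic fusionSign) :
    letI := commonEdgeStructure c
    BackAndForth Language.graph V M := by
  let := commonEdgeStructure c
  intro α _ f g h x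
  by_cases hx : x ∈ Set.range f
  · obtain ⟨s, rfl⟩ := hx
    have := atomicType_comp h (fun o : Option α => o.elim s id)
    have key : ∀ {U : Type} (k : α → U),
        k ∘ (fun o : Option α => o.elim s id) = fun o => o.elim (k s) k := by
      intro U k
      funext o
      cases o <;> rfl
    rw [key, key] at this
    exact ⟨g s, this⟩
  · obtain ⟨p₁, p₂⟩ := atomicType_graph_eq_iff.1 h
    let e : M → Prop := fun b => ∃ s, g s = b ∧ RelMap Language.adj ![x, f s]
    have he : ∀ s, e (g s) ↔ RelMap Language.adj ![x, f s] := by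
      refine fun s => ⟨?_, fun H => ⟨s, rfl, H⟩⟩
      rintro ⟨t, ht, H⟩
      rwa [(p₁ t s).2 ht] at H
    -- Both colours join `y` to the prescribed neighbours, with a hyperedge exactly over the
    -- 0-coloured pairs of neighbours. The rule for colour 0 is then automatic. A violation for
    -- colour 1 would be a pair of neighbours carrying both colours, hence a triangle in `V`.
    obtain ⟨y, hy, hE, -⟩ := hc.extend (Set.range g) (Set.finite_range g) (fun _ => e)
      (fun a b => e a ∧ e b ∧ c.E 0 a b) ⟨by
        rintro a - b - ⟨ha, hb, H⟩
        refine ⟨⟨hb, ha, hc.good.E_symm.1 H⟩, ?_⟩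
        rintro rfl
        exact (hc.good.graph 0).2 _ H, by
        rintro i _ ⟨s, rfl⟩ _ ⟨t, rfl⟩ hs ht hst
        fin_cases i
        · exact iff_of_true ⟨hs, ht, hst⟩ trivial
        · refine iff_of_false (fun H => ?_) (fun H => H)
          rw [he] at hs ht
          exact hV.2 x (f s) (f t) ⟨hs, (p₂ s t).2 ⟨H.2.2, hst⟩, hV.1.1 _ _ ht⟩⟩
    have hadj : ∀ s, RelMap Language.adj ![y, g s] ↔ RelMap Language.adj ![x, f s] := by
      intro s
      rw [← he]
      have h₀ := hE 0 (g s) ⟨s, rfl⟩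
      have h₁ := hE 1 (g s) ⟨s, rfl⟩
      exact ⟨fun H => h₀.1 H.1, fun H => ⟨h₀.2 H, h₁.2 H⟩⟩
    have hM := isTriangleFree_commonEdgeStructure hc.good
    refine ⟨y, atomicType_graph_eq_iff.2 ⟨?_, ?_⟩⟩
    · rintro (_ | s) (_ | t)
      · simp
      · exact iff_of_false (fun H => hx ⟨t, H.symm⟩) (fun H => hy ⟨t, H.symm⟩)
      · exact iff_of_false (fun H => hx ⟨s, H⟩) (fun H => hy ⟨s, H⟩)
      · exact p₁ s t
    · rintro (_ | s) (_ | t)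
      · exact iff_of_false (hV.1.2 _) (hM.1.2 _)
      · exact (hadj t).symm
      · exact ⟨fun H => hM.1.1 _ _ ((hadj s).2 (hV.1.1 _ _ H)),
          fun H => hV.1.1 _ _ ((hadj s).1 (hM.1.1 _ _ H))⟩
      · exact p₂ s t

theorem elementarilyEquivalent_commonEdgeStructure {c : ColoredHypergraph (Fin 2) M}
    (hc : c.Generic fusionSign) {d : ColoredHypergraph (Fin 2) N} (hd : d.Generic fusionSign) :
    letI := commonEdgeStructure c
    letI := commonEdgeStructure d
    M ≅[Language.graph] N := by
  let := commonEdgeStructure c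
  let := commonEdgeStructure d
  exact elementarilyEquivalent_of_backAndForth
    (backAndForth_commonEdgeStructure (isTriangleFree_commonEdgeStructure hc.good) hd)
    (backAndForth_commonEdgeStructure (isTriangleFree_commonEdgeStructure hd.good) hc)

end

/-- The theory of the Henson graph. -/
noncomputable def hensonTheory : Language.graph.Theory :=
  letI := commonEdgeStructure (exists_generic fusionSign).choose
  Language.graph.completeTheory ℕ

theorem isTheoryOfFraisseLimit_hensonTheory :
    IsTheoryOfFraisseLimit finiteTriangleFreeGraphs hensonTheory := by
  have hc := (exists_generic fusionSign).choose_spec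
  let := commonEdgeStructure (exists_generic fusionSign).choose
  have hM := isTriangleFree_commonEdgeStructure hc.good
  exact ⟨ℕ, this, inferInstance, isFraisseLimit_of_backAndForth _
    (backAndForth_commonEdgeStructure hM hc)
    (fun V hV => ⟨hV.1, backAndForth_commonEdgeStructure hV.2 hc⟩)
    (fun V hV f => ⟨hV, hM.of_embedding f⟩), rfl⟩

/-- The language of the fusion. -/
local notation "L∪" => unionLanguage hypergraphLanguage extraSymbols

/-- The formula saying that two vertices are joined by edges of both colours. -/
noncomputable def commonEdge {α : Type} (x y : α) : (L∪).Formula α :=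
  Relations.formula₂ ((symbols (L := L∪) 2).symm (.edge 0)) (var x) (var y) ⊓
    Relations.formula₂ ((symbols (L := L∪) 2).symm (.edge 1)) (var x) (var y)

theorem realize_commonEdge {α M : Type} [(L∪).Structure M] {x y : α} {v : α → M} :
    (commonEdge x y).Realize v ↔
      (toColored L∪ M).E 0 (v x) (v y) ∧ (toColored L∪ M).E 1 (v x) (v y) := by
  rw [commonEdge, Formula.realize_inf, Formula.realize_rel₂, Formula.realize_rel₂]
  rfl

theorem isInterpretableIn_hensonTheory :
    IsInterpretableIn hensonTheory (genericTheory L∪ fusionSign) := by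
  let F : InterpretationData Language.graph L∪ :=
    { dim := 1
      dom := ⊤
      eqv := Term.equal (var (0, 0)) (var (1, 0))
      rel := fun r => match r with
        | .adj => commonEdge (0, 0) (1, 0)
      fn := fun _ => ⊥ }
  refine ⟨F, fun M => ?_⟩
  have hM := model_genericTheory_iff.1 M.is_model
  let := commonEdgeStructure (toColored L∪ M)
  have hmodel : M ⊨ hensonTheory := by
    let := commonEdgeStructure (exists_generic fusionSign).choose
    have := elementarilyEquivalent_commonEdgeStructure (exists_generic fusionSign).choose_spec hM
    exact this.theory_model_iff.1 model_completeTheory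
  refine ⟨Theory.ModelType.of hensonTheory M, fun a => a.1 0, fun x => ?_, fun a b => ?_, ?_, ?_⟩
  · exact ⟨⟨fun _ => x, Formula.realize_top.2 trivial⟩, rfl⟩
  · simp only [F, Formula.realize_equal, Term.realize_var]
    constructor
    · exact fun h => h
    · exact fun h => h
  · rintro k ⟨⟩ a
    exact realize_commonEdge
  · intro k f
    exact isEmptyElim f

/-! ### Coding triangle-free graphs: $\mathrm{SOP}_3$ and $\mathrm{SOP}_1$ -/

/-- Countable triangle-free graphs embed in all generic structures. -/
theorem exists_map_of_triangleFree {W : Type} [Countable W] (G : W → W → Prop)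
    (hG : IsGraphRelation G) (htri : ∀ x y z, G x y → G y z → ¬ G z x) {M : Type}
    [(L∪).Structure M] (hM : (toColored L∪ M).Generic fusionSign) :
    ∃ g : W → M, ∀ i x y, (toColored L∪ M).E i (g x) (g y) ↔ G x y := by
  -- Both colours equal `G`; without triangles the rules are vacuous and no hyperedges are needed.
  let d : ColoredHypergraph (Fin 2) W := ⟨fun _ _ _ => False, fun _ => G⟩
  let := ofColored L∪ d
  have hd : (toColored L∪ W).Good fusionSign := by
    rw [toColored_ofColored]
    exact ⟨fun _ _ _ h => h.elim, fun _ => hG, fun _ x y z h₁ h₂ h₃ => (htri x y z h₁ h₂ h₃).elim⟩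
  obtain ⟨f⟩ := exists_embedding_of_backAndForth (backAndForth_of_generic hd hM)
  refine ⟨f, fun i x y => ?_⟩
  have := (pattern_eq_iff.1 (atomicType_eq_iff_pattern_eq.1
    (atomicType_embedding_comp f (id : W → W)))).2.2 i x y
  rw [toColored_ofColored] at this
  exact this

/-- Join `(i, s)` to `(j, s + 1)` for `i < j`, with `s` modulo 3. A triangle would run through all
three residues with the first coordinate strictly increasing around the cycle. Conversely, a 3-cycle
of the formula contains the common-edge triangle `x 0`, `y 1`, `z 2`. -/
theorem hasSOP3_genericTheory : HasSOP3 (genericTheory L∪ fusionSign) := by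
  obtain ⟨_, hM⟩ := exists_countable_generic L∪ fusionSign
  have := model_genericTheory_iff.2 hM
  let G : ℕ × Fin 3 → ℕ × Fin 3 → Prop := fun p q =>
    (p.1 < q.1 ∧ q.2 = p.2 + 1) ∨ (q.1 < p.1 ∧ p.2 = q.2 + 1)
  obtain ⟨g, hg⟩ := exists_map_of_triangleFree G ⟨fun p q h => h.symm, fun p h => by
      rcases h with h | h <;> exact lt_irrefl _ h.1⟩ (by
      rintro ⟨i, s⟩ ⟨j, t⟩ ⟨k, u⟩ (⟨h₁, h₁'⟩ | ⟨h₁, h₁'⟩) (⟨h₂, h₂'⟩ | ⟨h₂, h₂'⟩)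
        (⟨h₃, h₃'⟩ | ⟨h₃, h₃'⟩) <;> dsimp only at h₁ h₂ h₃ h₁' h₂' h₃' <;> omega) hM
  refine ⟨3, commonEdge (Sum.inl 0) (Sum.inr 1) ⊓ commonEdge (Sum.inl 1) (Sum.inr 2) ⊓
    commonEdge (Sum.inl 2) (Sum.inr 0), Theory.ModelType.of _ ℕ, ⟨fun i s => g (i, s), ?_⟩, ?_⟩
  · intro i j hij
    simp only [Formula.realize_inf, realize_commonEdge]
    refine ⟨⟨⟨?_, ?_⟩, ?_, ?_⟩, ?_, ?_⟩ <;> exact (hg _ _ _).2 (Or.inl ⟨hij, rfl⟩)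
  · rintro ⟨x, y, z, h₁, h₂, h₃⟩
    simp only [Formula.realize_inf, realize_commonEdge] at h₁ h₂ h₃
    exact not_common_triangle hM.good h₁.1.1 h₂.1.2 h₃.2

theorem getElem?_initialSegment {α : Type} {σ : ℕ → α} {n p : ℕ} {x : α}
    (h : (initialSegment σ n)[p]? = some x) : x = σ p := by
  obtain ⟨hp, hx⟩ := List.getElem?_eq_some_iff.1 h
  simpa [initialSegment] using hx.symm

/-- The formula says that `x` is joined to both entries of the parameter. An edge between one entry
of `b η` and one entry of `b (ν⌢1)`, whenever `η` extends `ν⌢0`, makes the two instances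
inconsistent. The graph of these edges is bipartite, hence triangle-free, and has no edges along a
branch. -/
theorem hasSOP1_genericTheory : ∃ φ : (L∪).Formula (Fin 1 ⊕ Fin 2),
    HasSOP1 (genericTheory L∪ fusionSign) φ := by
  obtain ⟨_, hM⟩ := exists_countable_generic L∪ fusionSign
  have := model_genericTheory_iff.2 hM
  let H : List Bool × Bool → List Bool × Bool → Prop := fun p q => p.2 = false ∧ q.2 = true ∧
    ∃ ν, q.1 = ν ++ [true] ∧ (ν ++ [false]) <+: p.1
  let G : List Bool × Bool → List Bool × Bool → Prop := fun p q => H p q ∨ H q p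
  have hG : ∀ p q, G p q → p.2 ≠ q.2 := by
    rintro p q (⟨h₁, h₂, -⟩ | ⟨h₁, h₂, -⟩) <;> simp [h₁, h₂]
  obtain ⟨g, hg⟩ := exists_map_of_triangleFree G
    ⟨fun p q h => h.symm, fun p h => hG p p h rfl⟩ (by
      rintro ⟨η, a⟩ ⟨μ, b⟩ ⟨ν, d⟩ h₁ h₂ h₃
      have h₁ := hG _ _ h₁
      have h₂ := hG _ _ h₂
      have h₃ := hG _ _ h₃
      revert h₁ h₂ h₃
      cases a <;> cases b <;> cases d <;> simp) hM
  refine ⟨commonEdge (Sum.inl 0) (Sum.inr 0) ⊓ commonEdge (Sum.inl 0) (Sum.inr 1),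
    Theory.ModelType.of _ ℕ, fun η => ![g (η, false), g (η, true)], ?_, ?_⟩
  · rintro ν η hη ⟨a, h₁, h₂⟩
    simp only [Formula.realize_inf, realize_commonEdge] at h₁ h₂
    have hedge : G (η, false) (ν ++ [true], true) := Or.inl ⟨rfl, rfl, ν, rfl, hη⟩
    exact not_common_triangle hM.good h₁.1 ⟨(hg 0 _ _).2 hedge, (hg 1 _ _).2 hedge⟩
      ⟨hM.good.E_symm.1 h₂.2.1, hM.good.E_symm.1 h₂.2.2⟩
  · intro σ N
    have hH : ∀ i j s t, ¬ H (initialSegment σ i, s) (initialSegment σ j, t) := by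
      rintro i j s t ⟨-, -, ν, h₁, h₂⟩
      dsimp only at h₁ h₂
      have h₁' : true = σ ν.length := getElem?_initialSegment (n := j) (by simp [h₁])
      have h₂' : false = σ ν.length := by
        obtain ⟨r, hr⟩ := h₂
        exact getElem?_initialSegment (n := i) (by simp [← hr])
      rw [← h₂'] at h₁'
      cases h₁'
    let S : Set ℕ := (fun p : ℕ × Bool => g (initialSegment σ p.1, p.2)) '' (Set.Iic N ×ˢ Set.univ)
    -- As `S` spans no edges, a vertex joined to all of it creates no triangle and needs no
    -- hyperedge.
    obtain ⟨x, -, hE, -⟩ := hM.extend S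
      (((Set.finite_Iic N).prod Set.finite_univ).image _) (fun _ _ => True) (fun _ _ => False)
      ⟨fun _ _ _ _ h => h.elim, by
        rintro i _ ⟨p, -, rfl⟩ _ ⟨q, -, rfl⟩ - - h
        rcases (hg i _ _).1 h with h | h
        · exact (hH _ _ _ _ h).elim
        · exact (hH _ _ _ _ h).elim⟩
    refine ⟨fun _ => x, fun j hj => ?_⟩
    simp only [Formula.realize_inf, realize_commonEdge]
    have : ∀ i t, (toColored L∪ ℕ).E i x (g (initialSegment σ j, t)) := fun i t =>
      (hE i _ ⟨(j, t), ⟨hj, trivial⟩, rfl⟩).2 trivial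
    exact ⟨⟨this 0 false, this 1 false⟩, this 0 true, this 1 true⟩

end HensonGraph

/-! ### Instability -/

namespace ColoredLanguage

open ColoredHypergraph AtomicTypes

theorem not_isStable_genericTheory {L : FirstOrder.Language.{0, 0}} {I : Type}
    [ColoredLanguage L I] [Finite I] (sgn : I → Prop) : ¬ IsStable (genericTheory L sgn) := by
  intro hst
  obtain ⟨_, hM⟩ := exists_countable_generic L sgn
  have hmodel := model_genericTheory_iff.2 hM
  -- A half-graph coded by hyperedges: $R(a_i, b_j, c)$ holds if and only if $i < j$, with `c = (2,
  -- 0)` fixed below. There are no coloured edges, so goodness holds for every `sgn`.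
  let s : Fin 3 × ℕ → Fin 3 × ℕ → Fin 3 × ℕ → Prop := fun p q r =>
    p.1 = 0 ∧ q.1 = 1 ∧ r.1 = 2 ∧ p.2 < q.2
  let d : ColoredHypergraph I (Fin 3 × ℕ) :=
    ⟨fun p q r => s p q r ∨ s p r q ∨ s q p r ∨ s q r p ∨ s r p q ∨ s r q p, fun _ _ _ => False⟩
  let := ofColored L d
  have hd : (toColored L (Fin 3 × ℕ)).Good sgn := by
    rw [toColored_ofColored]
    refine ⟨fun p q r h => ⟨⟨?_, ?_⟩, ?_⟩, fun _ => ⟨fun _ _ h => h, fun _ h => h⟩,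
      fun _ _ _ _ h => h.elim⟩
    · rcases h with h | h | h | h | h | h
      · exact Or.inr (Or.inr (Or.inl h))
      · exact Or.inr (Or.inr (Or.inr (Or.inl h)))
      · exact Or.inl h
      · exact Or.inr (Or.inl h)
      · exact Or.inr (Or.inr (Or.inr (Or.inr (Or.inr h))))
      · exact Or.inr (Or.inr (Or.inr (Or.inr (Or.inl h))))
    · rcases h with h | h | h | h | h | h
      · exact Or.inr (Or.inr (Or.inr (Or.inr (Or.inl h))))
      · exact Or.inr (Or.inr (Or.inr (Or.inr (Or.inr h))))
      · exact Or.inr (Or.inl h)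
      · exact Or.inl h
      · exact Or.inr (Or.inr (Or.inr (Or.inl h)))
      · exact Or.inr (Or.inr (Or.inl h))
    · refine ⟨?_, ?_, ?_⟩ <;> rintro rfl <;> rcases h with h | h | h | h | h | h <;>
        obtain ⟨h₁, h₂, h₃, -⟩ := h <;> simp_all
  obtain ⟨f⟩ := exists_embedding_of_backAndForth (backAndForth_of_generic hd hM)
  have hf : ∀ p q r, (toColored L ℕ).R (f p) (f q) (f r) ↔ d.R p q r := by
    intro p q r
    have := (pattern_eq_iff.1 (atomicType_eq_iff_pattern_eq.1
      (atomicType_embedding_comp f (id : Fin 3 × ℕ → Fin 3 × ℕ)))).2.1 p q r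
    rw [toColored_ofColored] at this
    exact this
  refine hst 1 2 (((symbols (L := L) 3).symm .hyper).formula
    ![var (Sum.inl 0), var (Sum.inr 0), var (Sum.inr 1)]) ⟨Theory.ModelType.of _ ℕ,
      fun i _ => f (0, i), fun j => ![f (1, j), f (2, 0)], fun i j => ?_⟩
  rw [Formula.realize_rel]
  have h := hf (0, i) (1, j) (2, 0)
  simp only [d, s] at h
  simp only [toColored] at h
  refine Iff.trans (iff_of_eq (congrArg _ ?_)) (h.trans (by simp))
  funext k
  fin_cases k <;> rfl

end ColoredLanguage

theorem mainTheorem9 :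
    ∃ (T₀ : hypergraphLanguage.Theory) (T₁ T₂ : expandedLanguage.Theory)
      (T_Henson : FirstOrder.Language.graph.Theory),
      -- the theories of the random 3-hypergraph, of its two expansions, and of the Henson graph
      IsTheoryOfFraisseLimit finiteHypergraphs T₀ ∧
      IsTheoryOfFraisseLimit classK₁ T₁ ∧
      IsTheoryOfFraisseLimit classK₂ T₂ ∧
      IsTheoryOfFraisseLimit finiteTriangleFreeGraphs T_Henson ∧
      -- the setting: `T₀` is the set of `L_∩`-consequences of each `Tᵢ`
      (∀ i : Fin 2, IsBaseConsequences T₀ (pair T₁ T₂ i)) ∧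
      -- properties of the three theories
      (IsSimple T₀ ∧ IsSimple T₁ ∧ IsSimple T₂) ∧
      (IsAlephZeroCategorical T₀ ∧ IsAlephZeroCategorical T₁ ∧ IsAlephZeroCategorical T₂) ∧
      (HasTrivialAcl T₀ ∧ HasTrivialAcl T₁ ∧ HasTrivialAcl T₂) ∧
      -- the fusion
      FusionExists (pair T₁ T₂) ∧
      (fusion (pair T₁ T₂)).IsComplete ∧
      IsAlephZeroCategorical (fusion (pair T₁ T₂)) ∧
      IsInterpretableIn T_Henson (fusion (pair T₁ T₂)) ∧
      HasSOP3 (fusion (pair T₁ T₂)) ∧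
      ¬ IsNSOP1 (fusion (pair T₁ T₂)) ∧
      -- stability of `T₀` cannot be dropped in the preservation of `NSOP₁`
      (IsNSOP1 T₁ ∧ IsNSOP1 T₂ ∧ ¬ IsStable T₀) := by
  have hcomp : fusion (pair (ColoredLanguage.componentTheory 0)
      (ColoredLanguage.componentTheory 1)) = _ := ColoredLanguage.fusion_eq
  have hsimple : ∀ i, IsSimple (ColoredLanguage.componentTheory i) :=
    fun i => ColoredLanguage.isSimple_genericTheory
  refine ⟨ColoredLanguage.genericTheory hypergraphLanguage fun i => i.elim,
    ColoredLanguage.componentTheory 0, ColoredLanguage.componentTheory 1,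
    HensonGraph.hensonTheory, ?_⟩
  rw [hcomp]
  exact ⟨ColoredLanguage.isTheoryOfFraisseLimit_genericTheory _
      ColoredLanguage.mem_finiteHypergraphs_iff,
    ColoredLanguage.isTheoryOfFraisseLimit_genericTheory _ ColoredLanguage.mem_classK₁_iff,
    ColoredLanguage.isTheoryOfFraisseLimit_genericTheory _ ColoredLanguage.mem_classK₂_iff,
    HensonGraph.isTheoryOfFraisseLimit_hensonTheory,
    ColoredLanguage.isBaseConsequences,
    ⟨ColoredLanguage.isSimple_genericTheory, hsimple 0, hsimple 1⟩,
    ⟨ColoredLanguage.isAlephZeroCategorical_genericTheory,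
      ColoredLanguage.isAlephZeroCategorical_genericTheory,
      ColoredLanguage.isAlephZeroCategorical_genericTheory⟩,
    ⟨ColoredLanguage.hasTrivialAcl_genericTheory, ColoredLanguage.hasTrivialAcl_genericTheory,
      ColoredLanguage.hasTrivialAcl_genericTheory⟩,
    ⟨_, fun M _ _ => ColoredLanguage.model_fusion_iff⟩,
    ColoredLanguage.isComplete_genericTheory _,
    ColoredLanguage.isAlephZeroCategorical_genericTheory,
    HensonGraph.isInterpretableIn_hensonTheory,
    HensonGraph.hasSOP3_genericTheory,
    fun h => HensonGraph.hasSOP1_genericTheory.elim fun φ hφ => h 1 2 φ hφ,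
    IsSimple.isNSOP1 (hsimple 0), IsSimple.isNSOP1 (hsimple 1),
    ColoredLanguage.not_isStable_genericTheory _⟩
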